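/- Let $n>4$ and let $P_n$ be a convex $n$-gon whose vertices are labelled cyclically by $0,1,\dots,n-1\in\mathbb Z_n$. A triangulation of $P_n$ (without extra vertices) is triangle-free if none of its triangles has three internal edges (chords). A proper coloring of such a triangulation is a labelling of its chords, bijectively, by $0,\dots,n-4$ such that the chord labelled $0$ is short (joins $i-1$ and $i+1$ for some $i\in\mathbb Z_n$), and whenever a triangle has exactly two internal edges, their labels are consecutive integers. Let $\Gamma_n$ be the graph whose vertices are the properly colored triangle-free triangulations of $P_n$, two of them being adjacent if one is obtained from the other by a flip of one chord, i.e. by replacing that chord by the other diagonal of the quadrangle formed by the two triangles containing it; the new chord gets the label of the old one and all other chords keep their labels. Let $T_0$ be the colored triangulation with chords $[0,2],[0,3],\dots,[0,n-2]$ labelled $0,1,\dots,n-4$ respectively, and let $T_0^R$ be the same triangulation with the reversed labelling (label $i$ replaced by $n-4-i$). Every geodesic (shortest path) in $\Gamma_n$ from $T_0$ to $T_0^R$ flips (removes as a chord by a flip) every diagonal of $P_n$ exactly once, and so determines a linear order on the set of the $n(n-3)/2$ diagonals of $P_n$, in which $d$ precedes $e$ if $d$ is flipped before $e$. A binary relation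 on the set of diagonals of $P_n$ is the (reflexive) linear order determined by some geodesic from $T_0$ to $T_0^R$ if and only if it is a linear extension of one of the following two partial orders: the coordinatewise order on diagonals with respect to the natural order $$0<1<2<\dots<n-1$$ of the vertices, or the coordinatewise order on diagonals with respect to the order $$0\equiv n<n-1<n-2<\dots<1$$ of the vertices. Here, for a given linear order $\prec$ of the vertices, write each diagonal as $[i,j]$ with $i\prec j$; then $[i,j]\le[k,l]$ in the coordinatewise order if and only if $i\preceq k$ and $j\preceq l$. -/

import Mathlib

namespace FlipGraph

/-- The edges of a convex `n`-gon, whose vertices are labelled, in cyclic order, by `ZMod n`. A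
segment between two vertices is an unordered pair. -/
def IsExternal {n : ℕ} (e : Sym2 (ZMod n)) : Prop :=
  ∃ a : ZMod n, e = s(a, a + 1)

/-- The diagonals of the polygon: segments between distinct non-adjacent vertices. -/
def Diagonal (n : ℕ) : Type :=
  {e : Sym2 (ZMod n) // ¬ e.IsDiag ∧ ¬ IsExternal e}

/-- Two segments cross in their interiors: their endpoints are distinct and interlace. -/
def Crosses {n : ℕ} (e f : Sym2 (ZMod n)) : Prop :=
  ∃ a b c d : ZMod n, a.val < b.val ∧ b.val < c.val ∧ c.val < d.val ∧
    ((e = s(a, c) ∧ f = s(b, d)) ∨ (e = s(b, d) ∧ f = s(a, c)))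

/-- A triangulation without extra vertices, given by its chords: a maximal set of pairwise
non-crossing diagonals. -/
def IsTriangulation {n : ℕ} (S : Set (Diagonal n)) : Prop :=
  (∀ d ∈ S, ∀ e ∈ S, ¬ Crosses d.1 e.1) ∧
    ∀ d : Diagonal n, (∀ e ∈ S, ¬ Crosses d.1 e.1) → d ∈ S

/-- The segment `e` is a chord of `S` (an internal edge). -/
def IsInternalEdge {n : ℕ} (S : Set (Diagonal n)) (e : Sym2 (ZMod n)) : Prop :=
  ∃ d ∈ S, d.1 = e

/-- The three vertices span a triangle of the triangulation `S`. -/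
def IsTriangle {n : ℕ} (S : Set (Diagonal n)) (a b c : ZMod n) : Prop :=
  a ≠ b ∧ b ≠ c ∧ a ≠ c ∧
    (IsInternalEdge S s(a, b) ∨ IsExternal s(a, b)) ∧
    (IsInternalEdge S s(b, c) ∨ IsExternal s(b, c)) ∧
    (IsInternalEdge S s(a, c) ∨ IsExternal s(a, c))

/-- No triangle has three internal edges. -/
def IsTriangleFree {n : ℕ} (S : Set (Diagonal n)) : Prop :=
  ∀ a b c : ZMod n, IsTriangle S a b c →
    ¬ (IsInternalEdge S s(a, b) ∧ IsInternalEdge S s(b, c) ∧ IsInternalEdge S s(a, c))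

/-- A short chord joins the two neighbours of some vertex. -/
def IsShort {n : ℕ} (e : Sym2 (ZMod n)) : Prop :=
  ∃ a : ZMod n, e = s(a - 1, a + 1)

/-- A list of `n - 3` diagonals labelled `0, …, n - 4`; `χ i` is the diagonal labelled `i`. -/
abbrev Labelling (n : ℕ) : Type := Fin (n - 3) → Diagonal n

/-- The labelled diagonals are distinct, form a triangle-free triangulation, and the labelling is
a proper colouring of it: the chord labelled `0` is short, and the two internal edges of a triangle
with exactly two internal edges have consecutive labels. -/
structure IsProperColoring {n : ℕ} (χ : Labelling n) : Prop where
  injective : Function.Injective χ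
  triangulation : IsTriangulation (Set.range χ)
  triangleFree : IsTriangleFree (Set.range χ)
  short_zero : ∀ i : Fin (n - 3), i.val = 0 → IsShort (χ i).1
  consecutive : ∀ (a b c : ZMod n) (i j : Fin (n - 3)), IsTriangle (Set.range χ) a b c →
    (χ i).1 = s(a, b) → (χ j).1 = s(b, c) → ¬ IsInternalEdge (Set.range χ) s(a, c) →
      i.val + 1 = j.val ∨ j.val + 1 = i.val

/-- Properly coloured triangle-free triangulations of the `n`-gon. -/
def CTFT (n : ℕ) : Type := {χ : Labelling n // IsProperColoring χ}

/-- `T'` arises from `T` by flipping the chord labelled `i`: this chord `ac` is the common side of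
two triangles `abc` and `acd` of `T`, it is replaced by the other diagonal `bd` of the quadrangle
`abcd`, which gets the label `i`, and all other chords keep their labels. -/
def IsFlip {n : ℕ} (i : Fin (n - 3)) (T T' : CTFT n) : Prop :=
  (∃ a b c d : ZMod n, b ≠ d ∧
    IsTriangle (Set.range T.1) a b c ∧ IsTriangle (Set.range T.1) a d c ∧
    (T.1 i).1 = s(a, c) ∧ (T'.1 i).1 = s(b, d)) ∧
  ∀ j, j ≠ i → T'.1 j = T.1 j

theorem IsFlip.symm {n : ℕ} {i : Fin (n - 3)} {T T' : CTFT n} (h : IsFlip i T T') :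
    IsFlip i T' T := by
  obtain ⟨⟨a, b, c, d, hbd, ⟨hab, hbc, hac, eab, ebc, eac⟩, ⟨had, hdc, -, ead, edc, -⟩,
    hi, hi'⟩, hj⟩ := h
  have key : ∀ e : Sym2 (ZMod n), e ≠ s(a, c) →
      (IsInternalEdge (Set.range T.1) e ∨ IsExternal e) →
      (IsInternalEdge (Set.range T'.1) e ∨ IsExternal e) := by
    rintro e he (⟨_, ⟨j, rfl⟩, rfl⟩ | h)
    · left
      have hji : j ≠ i := by
        rintro rfl
        exact he hi
      exact ⟨T'.1 j, ⟨j, rfl⟩, by rw [hj j hji]⟩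
    · exact Or.inr h
  have ebd : IsInternalEdge (Set.range T'.1) s(b, d) ∨ IsExternal s(b, d) :=
    Or.inl ⟨T'.1 i, ⟨i, rfl⟩, hi'⟩
  have kab := key s(a, b) (fun h => hbc (Sym2.congr_right.mp h)) eab
  have kbc := key s(b, c) (fun h => hab (Sym2.congr_left.mp h).symm) ebc
  have kad := key s(a, d) (fun h => hdc (Sym2.congr_right.mp h)) ead
  have kdc := key s(d, c) (fun h => had (Sym2.congr_left.mp h).symm) edc
  refine ⟨⟨b, a, d, c, hac, ⟨hab.symm, had, hbd, ?_, kad, ebd⟩,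
    ⟨hbc, hdc.symm, hbd, kbc, ?_, ebd⟩, hi', hi⟩, fun j h => (hj j h).symm⟩
  · rw [Sym2.eq_swap]
    exact kab
  · rw [Sym2.eq_swap]
    exact kdc

theorem IsFlip.ne {n : ℕ} {i : Fin (n - 3)} {T T' : CTFT n} (h : IsFlip i T T') : T ≠ T' := by
  rintro rfl
  obtain ⟨⟨a, b, c, d, hbd, ⟨hab, hbc, hac, -⟩, -, hi, hi'⟩, -⟩ := h
  rw [hi] at hi'
  rcases Sym2.eq_iff.mp hi' with h | h
  · exact hab h.1
  · exact hbc h.2.symm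

/-- The flip graph `Γ_n` on coloured triangle-free triangulations. -/
def Gamma (n : ℕ) : SimpleGraph (CTFT n) where
  Adj T T' := ∃ i, IsFlip i T T'
  symm := ⟨fun _ _ ⟨i, h⟩ => ⟨i, h.symm⟩⟩
  loopless := ⟨fun _ ⟨_, h⟩ => h.ne rfl⟩

/-- The reversed labelling: the chord labelled `i` gets the label `n - 4 - i`. -/
def Labelling.reverse {n : ℕ} (χ : Labelling n) : Labelling n := fun i => χ i.rev

theorem val_natCast {n k : ℕ} (h : k < n) : ((k : ℕ) : ZMod n).val = k :=
  ZMod.val_cast_of_lt h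

theorem cast_inj_of_lt {n k l : ℕ} (hk : k < n) (hl : l < n) (h : (k : ZMod n) = (l : ZMod n)) :
    k = l := by
  rw [← val_natCast hk, ← val_natCast hl, h]

theorem val_add_one {n : ℕ} (hn : 4 < n) (a : ZMod n) :
    (a + 1).val = if a.val + 1 = n then 0 else a.val + 1 := by
  have : NeZero n := ⟨by omega⟩
  have : Fact (1 < n) := ⟨by omega⟩
  have ha := a.val_lt
  rw [ZMod.val_add, ZMod.val_one]
  split_ifs with h
  · rw [h, Nat.mod_self]
  · exact Nat.mod_eq_of_lt (by omega)

/-- The diagonal `[0, i + 2]`. -/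
def starChord (n : ℕ) (hn : 4 < n) (i : Fin (n - 3)) : Diagonal n :=
  ⟨s(0, ((i.val + 2 : ℕ) : ZMod n)), by
    have hi := i.isLt
    have hv := val_natCast (n := n) (k := i.val + 2) (by omega)
    constructor
    · intro h
      have h' : (0 : ZMod n) = ((i.val + 2 : ℕ) : ZMod n) := by simpa using h
      rw [← h', ZMod.val_zero] at hv
      omega
    · rintro ⟨a, ha⟩
      have h1 := val_add_one hn a
      rcases Sym2.eq_iff.mp ha with ⟨h0, h2⟩ | ⟨h0, h2⟩
      · rw [← h2, ← h0, hv, ZMod.val_zero] at h1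
        split_ifs at h1 <;> omega
      · rw [← h0, ← h2, hv, ZMod.val_zero] at h1
        split_ifs at h1 <;> omega⟩

/-- The canonical star: the diagonals `[0, 2], [0, 3], …, [0, n - 2]`, labelled `0, …, n - 4`. -/
def starLabelling (n : ℕ) (hn : 4 < n) : Labelling n := starChord n hn

theorem starLabelling_injective {n : ℕ} (hn : 4 < n) :
    Function.Injective (starLabelling n hn) := by
  intro i j h
  have hi := i.isLt
  have hj := j.isLt
  have h' : s(0, ((i.val + 2 : ℕ) : ZMod n)) = s(0, ((j.val + 2 : ℕ) : ZMod n)) :=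
    congrArg Subtype.val h
  have h2 := cast_inj_of_lt (by omega) (by omega) (Sym2.congr_right.mp h')
  exact Fin.ext (by omega)

theorem starLabelling_triangulation {n : ℕ} (hn : 4 < n) :
    IsTriangulation (Set.range (starLabelling n hn)) := by
  have : NeZero n := ⟨by omega⟩
  constructor
  · rintro _ ⟨i, rfl⟩ _ ⟨j, rfl⟩ ⟨a, b, c, d, h1, h2, h3, ⟨hi, hj⟩ | ⟨hi, hj⟩⟩
    all_goals
      change s(0, _) = _ at hi
      change s(0, _) = _ at hj
      have m1 : (0 : ZMod n) = b ∨ (0 : ZMod n) = d := by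
        first
          | (rcases Sym2.eq_iff.mp hj with h | h <;> tauto)
          | (rcases Sym2.eq_iff.mp hi with h | h <;> tauto)
      rcases m1 with rfl | rfl <;> simp at h1 h2 h3
  · rintro ⟨e, he⟩ hcr
    have key : ∀ x y : ZMod n, x.val < y.val → e = s(x, y) →
        (⟨e, he⟩ : Diagonal n) ∈ Set.range (starLabelling n hn) := by
      intro x y hxy hexy
      have hy := y.val_lt
      have hext : x.val + 1 ≠ y.val := by
        intro h
        refine he.2 ⟨x, ?_⟩
        rw [hexy]
        congr 2
        apply ZMod.val_injective
        rw [val_add_one hn, if_neg (by omega), h]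
      rcases Nat.eq_zero_or_pos x.val with hx | hx
      · have hyn : y.val + 1 ≠ n := by
          intro h
          refine he.2 ⟨y, ?_⟩
          rw [hexy, Sym2.eq_swap]
          congr 2
          apply ZMod.val_injective
          rw [val_add_one hn, if_pos h, hx]
        refine ⟨⟨y.val - 2, by omega⟩, Subtype.ext ?_⟩
        change s(0, ((y.val - 2 + 2 : ℕ) : ZMod n)) = e
        have hy2 : y.val - 2 + 2 = y.val := by omega
        rw [hexy, hy2, ZMod.natCast_zmod_val, (ZMod.val_eq_zero x).mp hx]
      · exfalso
        refine hcr (starLabelling n hn ⟨x.val - 1, by omega⟩) ⟨_, rfl⟩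
          ⟨0, x, ((x.val - 1 + 2 : ℕ) : ZMod n), y, ?_, ?_, ?_, Or.inr ⟨hexy, rfl⟩⟩
        · rw [ZMod.val_zero]; exact hx
        · rw [val_natCast (by omega)]; omega
        · rw [val_natCast (by omega)]; omega
    induction e using Sym2.ind with
    | _ x y =>
      rcases lt_trichotomy x.val y.val with h | h | h
      · exact key x y h rfl
      · exact absurd (ZMod.val_injective n h) (by simpa using he.1)
      · exact key y x h Sym2.eq_swap

theorem zero_mem_star {n : ℕ} (hn : 4 < n) {a b : ZMod n}
    (h : IsInternalEdge (Set.range (starLabelling n hn)) s(a, b)) : a = 0 ∨ b = 0 := by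
  obtain ⟨_, ⟨i, rfl⟩, hi⟩ := h
  change s(0, _) = _ at hi
  rcases Sym2.eq_iff.mp hi with h | h
  · exact Or.inl h.1.symm
  · exact Or.inr h.1.symm

theorem starLabelling_triangleFree {n : ℕ} (hn : 4 < n) :
    IsTriangleFree (Set.range (starLabelling n hn)) := by
  rintro a b c ⟨hab, hbc, hac, -⟩ ⟨h1, h2, h3⟩
  have h1 := zero_mem_star hn h1
  have h2 := zero_mem_star hn h2
  have h3 := zero_mem_star hn h3
  grind

theorem starLabelling_consecutive {n : ℕ} (hn : 4 < n) (a b c : ZMod n) (i j : Fin (n - 3))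
    (ht : IsTriangle (Set.range (starLabelling n hn)) a b c)
    (hi : (starLabelling n hn i).1 = s(a, b)) (hj : (starLabelling n hn j).1 = s(b, c))
    (hac : ¬ IsInternalEdge (Set.range (starLabelling n hn)) s(a, c)) :
    i.val + 1 = j.val ∨ j.val + 1 = i.val := by
  obtain ⟨hab, hbc, hac', -, -, h3⟩ := ht
  have hi' := i.isLt
  have hj' := j.isLt
  have hext : IsExternal s(a, c) := h3.resolve_left hac
  have z1 := zero_mem_star hn ⟨_, ⟨i, rfl⟩, hi⟩
  have z2 := zero_mem_star hn ⟨_, ⟨j, rfl⟩, hj⟩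
  have hb : b = 0 := by grind
  subst hb
  change s(0, ((i.val + 2 : ℕ) : ZMod n)) = _ at hi
  change s(0, ((j.val + 2 : ℕ) : ZMod n)) = _ at hj
  rw [Sym2.eq_swap (a := a)] at hi
  have ha := Sym2.congr_right.mp hi
  have hc := Sym2.congr_right.mp hj
  have va := val_natCast (n := n) (k := i.val + 2) (by omega)
  have vc := val_natCast (n := n) (k := j.val + 2) (by omega)
  rw [ha] at va
  rw [hc] at vc
  obtain ⟨x, hx⟩ := hext
  have hv := val_add_one hn x
  rcases Sym2.eq_iff.mp hx with ⟨h1, h2⟩ | ⟨h1, h2⟩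
  · rw [← h2, ← h1, va, vc] at hv
    split_ifs at hv <;> omega
  · rw [← h1, ← h2, va, vc] at hv
    split_ifs at hv <;> omega

theorem starLabelling_proper {n : ℕ} (hn : 4 < n) : IsProperColoring (starLabelling n hn) where
  injective := starLabelling_injective hn
  triangulation := starLabelling_triangulation hn
  triangleFree := starLabelling_triangleFree hn
  short_zero i hi := by
    refine ⟨1, ?_⟩
    change s(0, ((i.val + 2 : ℕ) : ZMod n)) = _
    rw [hi, sub_self, one_add_one_eq_two]
    norm_num
  consecutive := starLabelling_consecutive hn

theorem range_reverse {n : ℕ} (χ : Labelling n) : Set.range χ.reverse = Set.range χ :=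
  Fin.rev_surjective.range_comp χ

theorem starLabelling_reverse_proper {n : ℕ} (hn : 4 < n) :
    IsProperColoring (starLabelling n hn).reverse where
  injective := (starLabelling_injective hn).comp Fin.rev_injective
  triangulation := by
    rw [range_reverse]
    exact starLabelling_triangulation hn
  triangleFree := by
    rw [range_reverse]
    exact starLabelling_triangleFree hn
  short_zero i hi := by
    refine ⟨-1, ?_⟩
    change s(0, ((i.rev.val + 2 : ℕ) : ZMod n)) = _
    have h : i.rev.val + 2 = n - 2 := by
      rw [Fin.val_rev]
      omega
    have h2 : -1 - 1 = (((n - 2 : ℕ)) : ZMod n) := by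
      rw [Nat.cast_sub (by omega), ZMod.natCast_self]
      push_cast
      ring
    rw [h, h2, neg_add_cancel, Sym2.eq_swap]
  consecutive a b c i j ht hi hj hac := by
    rw [range_reverse] at ht hac
    have h := starLabelling_consecutive hn a b c i.rev j.rev ht hi hj hac
    have hi' := i.isLt
    have hj' := j.isLt
    rw [Fin.val_rev, Fin.val_rev] at h
    omega

/-- The canonical coloured star triangulation `T_0`. -/
def star (n : ℕ) (hn : 4 < n) : CTFT n := ⟨starLabelling n hn, starLabelling_proper hn⟩

/-- `T_0^R`: the star triangulation with reversed colouring. -/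
def starReverse (n : ℕ) (hn : 4 < n) : CTFT n :=
  ⟨(starLabelling n hn).reverse, starLabelling_reverse_proper hn⟩

/-- A geodesic: a walk whose length is the distance of its endpoints. -/
def IsGeodesic {n : ℕ} {T T' : CTFT n} (p : (Gamma n).Walk T T') : Prop :=
  p.length = (Gamma n).dist T T'

/-- The `k`-th step (counted from `0`) of the walk `p` flips the diagonal `d`, that is, it replaces
the chord `d` by another diagonal. -/
def FlipsAt {n : ℕ} {T T' : CTFT n} (p : (Gamma n).Walk T T') (k : ℕ) (d : Diagonal n) : Prop :=
  k < p.length ∧ ∃ i, IsFlip i (p.getVert k) (p.getVert (k + 1)) ∧ (p.getVert k).1 i = d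

/-- `r` is the flip order of `p`: each diagonal `d` is flipped in exactly one step `t d` of `p`,
and `r d e` holds when `d` is flipped no later than `e`. -/
def IsFlipOrder {n : ℕ} {T T' : CTFT n} (p : (Gamma n).Walk T T')
    (r : Diagonal n → Diagonal n → Prop) : Prop :=
  ∃ t : Diagonal n → ℕ, (∀ d k, FlipsAt p k d ↔ k = t d) ∧ ∀ d e, r d e ↔ t d ≤ t e

/-- The coordinatewise order on diagonals, when the vertices are ordered by their ranks `rk`: each
diagonal is written as the pair of its endpoints, smaller endpoint first. -/
def CoordLE {n : ℕ} (rk : ZMod n → ℕ) (d e : Diagonal n) : Prop :=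
  (d.1.map rk).inf ≤ (e.1.map rk).inf ∧ (d.1.map rk).sup ≤ (e.1.map rk).sup

/-- Ranks of the vertices in the natural order `0 < 1 < … < n - 1`. -/
def naturalRank {n : ℕ} (a : ZMod n) : ℕ := a.val

/-- Ranks of the vertices in the order `0 < n - 1 < n - 2 < … < 1`: vertex `0` has rank `0` and
vertex `i` has rank `n - i` for `0 < i < n`. -/
def reversedRank {n : ℕ} (a : ZMod n) : ℕ := (-a).val

/-- `r` is a linear order that extends the relation `s`. -/
def IsLinearExtension {α : Type*} (s r : α → α → Prop) : Prop :=
  IsLinearOrder α r ∧ ∀ x y, s x y → r x y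

end FlipGraph

namespace FlipGraph

/-! ### Integer representatives of vertices -/

/-! The proof unrolls everything to integers. In a properly coloured triangle-free triangulation the
chords taken in label order form a growing strip: the chord labelled `i` spans `i + 2` consecutive
sides, and passing to the next label extends the interval by one vertex at one of its ends. So the
triangulation is encoded by the integer starting points `y i` of these intervals, a sequence whose
steps are `0` or `-1`. Conversely every such sequence occurs (`exists_lift`,
`IsSlope.exists_lifts`), and the encoding is unique up to adding a common multiple of `n`
(`Lifts.unique`). A flip changes a single entry by `1` or `-1` (`Lifts.exists_of_isFlip`), so walks
lift as in a covering space.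

Lift a walk between the two stars, starting at `0`. Its end is `n - 2 - i` up to a translation by a
multiple of `n`, so the sum of the entries ends at an odd multiple of `n(n-3)/2`. Each flip changes
that sum by one. Hence `n(n-3)/2` steps are needed, and with exactly that many every step has the
same sign (`walk_length`). The two signs are exchanged by the reflection `a ↦ -a` together with
reversal of the labels; this is the parameter `ε`, and it produces the two vertex orders.

In a monotone lift `Z`, raising entry `i` from `a` to `a + 1` flips the diagonal whose ends have
ranks `a` and `a + i + 2`. Entry `i` climbs from `0` to `n - 2 - i`, so each diagonal is flipped
once, and the slope condition on `Z` says that the flipped diagonals form a down-set of the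
coordinatewise order (`IsMonotoneLift.exists_times`). Conversely, flipping the diagonals along a
linear extension preserves the slope condition (`exists_extension_step`, `exists_walk_upto`), which
also shows that the lower bound is attained (`isGeodesic_iff`). -/

theorem eq_of_cast_eq {n : ℕ} {r a b : ℤ} (ha : r ≤ a) (ha' : a < r + n) (hb : r ≤ b)
    (hb' : b < r + n) (h : (a : ZMod n) = b) : a = b := by
  rw [ZMod.intCast_eq_intCast_iff_dvd_sub] at h
  have := Int.eq_zero_of_abs_lt_dvd h (by rw [abs_lt]; constructor <;> omega)
  omega

theorem exists_cast_eq {n : ℕ} (hn : 0 < n) (r : ℤ) (x : ZMod n) :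
    ∃ a : ℤ, r ≤ a ∧ a < r + n ∧ (a : ZMod n) = x := by
  have : NeZero n := ⟨by omega⟩
  have := (x - r).val_lt
  refine ⟨r + (x - r).val, by omega, by omega, ?_⟩
  push_cast
  rw [ZMod.natCast_zmod_val]
  ring

theorem cast_add_self {n : ℕ} (a : ℤ) : ((a + n : ℤ) : ZMod n) = a := by
  simp

theorem cast_sub_self {n : ℕ} (a : ℤ) : ((a - n : ℤ) : ZMod n) = a := by
  simp

theorem segment_eq {n : ℕ} {r a b c d : ℤ} (ha : r ≤ a) (hab : a < b) (hb : b < r + n)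
    (hc : r ≤ c) (hcd : c < d) (hd : d < r + n)
    (h : s((a : ZMod n), (b : ZMod n)) = s((c : ZMod n), (d : ZMod n))) : a = c ∧ b = d := by
  rcases Sym2.eq_iff.mp h with ⟨h1, h2⟩ | ⟨h1, h2⟩
  · exact ⟨eq_of_cast_eq (r := r) (by omega) (by omega) (by omega) (by omega) h1,
      eq_of_cast_eq (r := r) (by omega) (by omega) (by omega) (by omega) h2⟩
  · have h1 := eq_of_cast_eq (r := r) (by omega) (by omega) (by omega) (by omega) h1
    have h2 := eq_of_cast_eq (r := r) (by omega) (by omega) (by omega) (by omega) h2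
    omega

theorem exists_segment_eq {n : ℕ} (hn : 0 < n) (r : ℤ) (e : Sym2 (ZMod n)) (he : ¬ e.IsDiag) :
    ∃ a b : ℤ, r ≤ a ∧ a < b ∧ b < r + n ∧ e = s((a : ZMod n), (b : ZMod n)) := by
  induction e using Sym2.ind with
  | _ x y =>
    obtain ⟨a, ha, ha', rfl⟩ := exists_cast_eq hn r x
    obtain ⟨b, hb, hb', rfl⟩ := exists_cast_eq hn r y
    rcases lt_trichotomy a b with h | h | h
    · exact ⟨a, b, ha, h, hb', rfl⟩
    · exact absurd (by simp [h]) he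
    · exact ⟨b, a, hb, h, ha', Sym2.eq_swap⟩

theorem isExternal_cast_iff {n : ℕ} (hn : 4 < n) {a b : ℤ} (hab : a < b) (hb : b < a + n) :
    IsExternal s((a : ZMod n), (b : ZMod n)) ↔ b = a + 1 ∨ b = a + n - 1 := by
  constructor
  · rintro ⟨x, hx⟩
    rcases Sym2.eq_iff.mp hx with ⟨h1, h2⟩ | ⟨h1, h2⟩
    · left
      refine eq_of_cast_eq (n := n) (r := a) (by omega) (by omega) (by omega) (by omega) ?_
      rw [h2, ← h1]
      push_cast
      ring
    · right
      refine eq_of_cast_eq (n := n) (r := a) (by omega) (by omega) (by omega) (by omega) ?_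
      rw [h2]
      push_cast
      rw [h1, ZMod.natCast_self]
      ring
  · rintro (rfl | rfl)
    · exact ⟨a, by push_cast; rfl⟩
    · refine ⟨((a + n - 1 : ℤ) : ZMod n), ?_⟩
      rw [Sym2.eq_swap]
      congr 2
      push_cast
      rw [ZMod.natCast_self]
      ring

theorem not_isDiag_cast {n : ℕ} {a b : ℤ} (hab : a < b) (hb : b < a + n) :
    ¬ (s((a : ZMod n), (b : ZMod n))).IsDiag := by
  intro h
  have := eq_of_cast_eq (n := n) (r := a) (by omega) (by omega) (by omega) (by omega)
    (Sym2.mk_isDiag_iff.mp h)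
  omega

theorem cast_ne {n : ℕ} {a b : ℤ} (hab : a < b) (hb : b < a + n) : (a : ZMod n) ≠ b :=
  fun h => not_isDiag_cast hab hb (Sym2.mk_isDiag_iff.mpr h)

/-- The diagonal joining two vertices given by integers. -/
def diagonalOf {n : ℕ} (hn : 4 < n) (a b : ℤ) (hab : a + 2 ≤ b) (hb : b + 2 ≤ a + n) :
    Diagonal n :=
  ⟨s((a : ZMod n), (b : ZMod n)), not_isDiag_cast (by omega) (by omega), by
    rw [isExternal_cast_iff hn (by omega) (by omega)]
    omega⟩

theorem Diagonal.exists_eq {n : ℕ} (hn : 4 < n) (r : ℤ) (d : Diagonal n) :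
    ∃ a b : ℤ, r ≤ a ∧ a + 2 ≤ b ∧ b < r + n ∧ b + 2 ≤ a + n ∧
      d.1 = s((a : ZMod n), (b : ZMod n)) := by
  obtain ⟨a, b, ha, hab, hb, h⟩ := exists_segment_eq (by omega) r d.1 d.2.1
  have := d.2.2
  rw [h, isExternal_cast_iff hn hab (by omega)] at this
  exact ⟨a, b, ha, by omega, hb, by omega, h⟩

/-! ### Crossing -/

/-- Crossing, expressed with integer representatives in the window `[r, r + n)`. -/
def CrossesFrom {n : ℕ} (r : ℤ) (e f : Sym2 (ZMod n)) : Prop :=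
  ∃ a b c d : ℤ, r ≤ a ∧ a < b ∧ b < c ∧ c < d ∧ d < r + n ∧
    ((e = s((a : ZMod n), (c : ZMod n)) ∧ f = s((b : ZMod n), (d : ZMod n))) ∨
      (e = s((b : ZMod n), (d : ZMod n)) ∧ f = s((a : ZMod n), (c : ZMod n))))

/-- Moving the window by one replaces the vertex `r` by `r + n`, which rotates an interlacing
quadruple cyclically and exchanges the roles of its two pairs. This frees crossing from the base
point built into `ZMod.val`. -/
theorem crossesFrom_succ {n : ℕ} (r : ℤ) (e f : Sym2 (ZMod n)) :
    CrossesFrom (r + 1) e f ↔ CrossesFrom r e f := by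
  constructor
  · rintro ⟨a, b, c, d, h1, h2, h3, h4, h5, h⟩
    by_cases hd : d = r + n
    · refine ⟨d - n, a, b, c, by omega, by omega, h2, h3, by omega, ?_⟩
      rw [cast_sub_self, Sym2.eq_swap (a := (d : ZMod n))]
      tauto
    · exact ⟨a, b, c, d, by omega, h2, h3, h4, by omega, h⟩
  · rintro ⟨a, b, c, d, h1, h2, h3, h4, h5, h⟩
    by_cases ha : a = r
    · refine ⟨b, c, d, a + n, by omega, h3, h4, by omega, by omega, ?_⟩
      rw [cast_add_self, Sym2.eq_swap (b := (a : ZMod n))]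
      tauto
    · exact ⟨a, b, c, d, by omega, h2, h3, h4, by omega, h⟩

theorem crosses_iff {n : ℕ} (hn : 4 < n) (r : ℤ) (e f : Sym2 (ZMod n)) :
    Crosses e f ↔ CrossesFrom r e f := by
  have : NeZero n := ⟨by omega⟩
  induction r using Int.induction_on with
  | zero =>
    constructor
    · rintro ⟨a, b, c, d, h1, h2, h3, h⟩
      have := d.val_lt
      refine ⟨a.val, b.val, c.val, d.val, by omega, by omega, by omega, by omega, by omega, ?_⟩
      simpa using h
    · rintro ⟨a, b, c, d, h1, h2, h3, h4, h5, h⟩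
      have key : ∀ x : ℤ, 0 ≤ x → x < n → (((x : ZMod n).val : ℕ) : ℤ) = x := by
        intro x h0 hx
        rw [ZMod.val_intCast, Int.emod_eq_of_lt h0 hx]
      have ka := key a (by omega) (by omega)
      have kb := key b (by omega) (by omega)
      have kc := key c (by omega) (by omega)
      have kd := key d (by omega) (by omega)
      exact ⟨a, b, c, d, by omega, by omega, by omega, h⟩
  | succ i ih => exact ih.trans (crossesFrom_succ _ _ _).symm
  | pred i ih =>
    refine ih.trans ?_
    rw [← crossesFrom_succ (-(i : ℤ) - 1), sub_add_cancel]

theorem crosses_of_lt {n : ℕ} (hn : 4 < n) {a b c d : ℤ} (h1 : a < b) (h2 : b < c) (h3 : c < d)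
    (h4 : d < a + n) :
    Crosses s((a : ZMod n), (c : ZMod n)) s((b : ZMod n), (d : ZMod n)) :=
  (crosses_iff hn a _ _).mpr ⟨a, b, c, d, le_rfl, h1, h2, h3, h4, Or.inl ⟨rfl, rfl⟩⟩

theorem Crosses.symm {n : ℕ} {e f : Sym2 (ZMod n)} (h : Crosses e f) : Crosses f e := by
  obtain ⟨a, b, c, d, h1, h2, h3, h⟩ := h
  exact ⟨a, b, c, d, h1, h2, h3, by tauto⟩

/-- Crossing of segments given by endpoints in a common window. -/
theorem crosses_cast_iff {n : ℕ} (hn : 4 < n) {r a b c d : ℤ} (ha : r ≤ a) (hab : a < b)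
    (hb : b < r + n) (hc : r ≤ c) (hcd : c < d) (hd : d < r + n) :
    Crosses s((a : ZMod n), (b : ZMod n)) s((c : ZMod n), (d : ZMod n)) ↔
      (a < c ∧ c < b ∧ b < d) ∨ (c < a ∧ a < d ∧ d < b) := by
  constructor
  · rw [crosses_iff hn r]
    rintro ⟨p, q, s, t, h1, h2, h3, h4, h5, ⟨he, hf⟩ | ⟨he, hf⟩⟩
    all_goals
      have := segment_eq (r := r) (by omega) (by omega) (by omega) (by omega) (by omega)
        (by omega) he
      have := segment_eq (r := r) (by omega) (by omega) (by omega) (by omega) (by omega)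
        (by omega) hf
      omega
  · rintro (⟨h1, h2, h3⟩ | ⟨h1, h2, h3⟩)
    · exact crosses_of_lt hn h1 h2 h3 (by omega)
    · exact (crosses_of_lt hn h1 h2 h3 (by omega)).symm

/-! ### Triangles of a triangulation -/

theorem not_isInternalEdge_of_isExternal {n : ℕ} {S : Set (Diagonal n)} {e : Sym2 (ZMod n)}
    (h : IsExternal e) : ¬ IsInternalEdge S e := by
  rintro ⟨d, -, rfl⟩
  exact d.2.2 h

/-- Each chord of a triangulation is a side of a triangle on its given side. -/
theorem exists_apex {n : ℕ} (hn : 4 < n) {S : Set (Diagonal n)} (hS : IsTriangulation S)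
    {a b : ℤ} (hab : a + 2 ≤ b) (hb : b + 2 ≤ a + n)
    (hin : IsInternalEdge S s((a : ZMod n), (b : ZMod n))) :
    ∃ c : ℤ, b < c ∧ c < a + n ∧
      (IsInternalEdge S s((b : ZMod n), (c : ZMod n)) ∨
        IsExternal s((b : ZMod n), (c : ZMod n))) ∧
      (IsInternalEdge S s((a : ZMod n), (c : ZMod n)) ∨
        IsExternal s((a : ZMod n), (c : ZMod n))) := by
  -- The apex is the farthest vertex before `a + n` joined to `b`. A chord crossing `[a, c]` but
  -- neither `[a, b]` nor `[b, c]` would have to start at `b` and end beyond `c`.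
  obtain ⟨c, ⟨hbc, hca, hc⟩, hmax⟩ := Int.exists_greatest_of_bdd
    (P := fun c => b < c ∧ c < a + n ∧
      (IsInternalEdge S s((b : ZMod n), (c : ZMod n)) ∨
        IsExternal s((b : ZMod n), (c : ZMod n))))
    ⟨a + n, fun z hz => hz.2.1.le⟩
    ⟨b + 1, by omega, by omega, Or.inr (by
      rw [isExternal_cast_iff hn (by omega) (by omega)]; exact Or.inl rfl)⟩
  refine ⟨c, hbc, hca, hc, ?_⟩
  by_cases hc1 : c = a + n - 1
  · exact Or.inr ((isExternal_cast_iff hn (by omega) (by omega)).mpr (Or.inr hc1))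
  left
  refine ⟨diagonalOf hn a c (by omega) (by omega), hS.2 _ ?_, rfl⟩
  intro e he hcr
  obtain ⟨q, t, hq, hqt, ht, -, heq⟩ := e.exists_eq hn a
  have hcr' : Crosses s((a : ZMod n), (c : ZMod n)) s((q : ZMod n), (t : ZMod n)) := by
    rw [← heq]
    exact hcr
  rw [crosses_cast_iff hn (r := a) (by omega) (by omega) (by omega) (by omega) (by omega)
    (by omega)] at hcr'
  obtain ⟨d, hd, hdeq⟩ := hin
  have h1 := hS.1 d hd e he
  rw [hdeq, heq, crosses_cast_iff hn (r := a) (by omega) (by omega) (by omega) (by omega)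
    (by omega) (by omega)] at h1
  by_cases hqb : q = b
  · have := hmax t ⟨by omega, by omega, Or.inl ⟨e, he, by rw [heq, hqb]⟩⟩
    omega
  rcases hc with ⟨f, hf, hfeq⟩ | hext
  · have h2 := hS.1 f hf e he
    rw [hfeq, heq, crosses_cast_iff hn (r := a) (by omega) (by omega) (by omega) (by omega)
      (by omega) (by omega)] at h2
    omega
  · rw [isExternal_cast_iff hn (by omega) (by omega)] at hext
    omega

theorem IsTriangle.swap {n : ℕ} {S : Set (Diagonal n)} {a b c : ZMod n} (h : IsTriangle S a b c) :
    IsTriangle S b a c := by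
  obtain ⟨h1, h2, h3, h4, h5, h6⟩ := h
  rw [Sym2.eq_swap] at h4
  exact ⟨h1.symm, h3, h2, h4, h6, h5⟩

/-! ### Lifts -/

/-- Sequences of integers whose consecutive differences are `0` or `-1`. -/
def IsSlope {m : ℕ} (y : Fin m → ℤ) : Prop :=
  ∀ i j : Fin m, j.val = i.val + 1 → y j = y i ∨ y j = y i - 1

/-- `y` describes `χ`: the chord labelled `i` joins `y i` and `y i + i + 2`. -/
def Lifts {n : ℕ} (y : Fin (n - 3) → ℤ) (χ : Labelling n) : Prop :=
  IsSlope y ∧ ∀ i : Fin (n - 3),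
    (χ i).1 = s(((y i : ℤ) : ZMod n), ((y i + i.val + 2 : ℤ) : ZMod n))

/-! ### Every proper colouring has a lift -/

/-- The triangle beyond the chord `k` has exactly one further internal side: two are excluded by
triangle-freeness, none would force `k = n - 4`. Its label is `k + 1` or `k - 1`, and `k - 1` is
impossible because by `hprev` that chord lies on the other side of chord `k`. The two values of `z`
tell which end of the interval grows. -/
theorem exists_next {n : ℕ} (hn : 4 < n) {χ : Labelling n} (hχ : IsProperColoring χ)
    (k l : Fin (n - 3)) (hl : l.val = k.val + 1) (a : ℤ)
    (hk : (χ k).1 = s((a : ZMod n), ((a + k.val + 2 : ℤ) : ZMod n)))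
    (hprev : ∀ i : Fin (n - 3), i.val + 1 = k.val → ∃ z : ℤ, (z = a ∨ z = a + 1) ∧
      (χ i).1 = s((z : ZMod n), ((z + i.val + 2 : ℤ) : ZMod n))) :
    ∃ z : ℤ, (z = a ∨ z = a - 1) ∧
      (χ l).1 = s((z : ZMod n), ((z + l.val + 2 : ℤ) : ZMod n)) := by
  have hlt := l.isLt
  have hint : IsInternalEdge (Set.range χ) s((a : ZMod n), ((a + k.val + 2 : ℤ) : ZMod n)) :=
    ⟨χ k, ⟨k, rfl⟩, hk⟩
  obtain ⟨c, hbc, hca, h1, h2⟩ := exists_apex hn hχ.triangulation (a := a)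
    (b := a + k.val + 2) (by omega) (by omega) hint
  have htri : IsTriangle (Set.range χ) (a : ZMod n) ((a + k.val + 2 : ℤ) : ZMod n) (c : ZMod n) :=
    ⟨cast_ne (by omega) (by omega), cast_ne (by omega) (by omega),
      cast_ne (by omega) (by omega), Or.inl hint, h1, h2⟩
  rcases h1 with h1 | h1 <;> rcases h2 with h2 | h2
  · exact absurd ⟨hint, h1, h2⟩ (hχ.triangleFree _ _ _ htri)
  · have h2' := (isExternal_cast_iff hn (by omega) (by omega)).mp h2
    obtain ⟨_, ⟨j, rfl⟩, hj⟩ := h1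
    rcases hχ.consecutive _ _ _ k j htri hk hj (not_isInternalEdge_of_isExternal h2) with h | h
    · obtain rfl : j = l := Fin.ext (by omega)
      refine ⟨a - 1, Or.inr rfl, ?_⟩
      have e1 : c = a - 1 + n := by omega
      have e2 : a + k.val + 2 = a - 1 + j.val + 2 := by omega
      rw [hj, Sym2.eq_swap, e1, cast_add_self, e2]
    · obtain ⟨z, hz, hz'⟩ := hprev j h
      rw [hj] at hz'
      have := segment_eq (r := a) (by omega) (by omega) (by omega) (by omega) (by omega)
        (by omega) hz'
      omega
  · have h1' := (isExternal_cast_iff hn (by omega) (by omega)).mp h1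
    obtain ⟨_, ⟨j, rfl⟩, hj⟩ := h2
    rcases hχ.consecutive _ _ _ k j htri.swap (by rw [hk, Sym2.eq_swap]) hj
      (not_isInternalEdge_of_isExternal h1) with h | h
    · obtain rfl : j = l := Fin.ext (by omega)
      refine ⟨a, Or.inl rfl, ?_⟩
      have e1 : c = a + j.val + 2 := by omega
      rw [hj, e1]
    · obtain ⟨z, hz, hz'⟩ := hprev j h
      rw [hj] at hz'
      have := segment_eq (r := a) (by omega) (by omega) (by omega) (by omega) (by omega)
        (by omega) hz'
      omega
  · rw [isExternal_cast_iff hn (by omega) (by omega)] at h1 h2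
    omega

theorem exists_lift_upto {n : ℕ} (hn : 4 < n) {χ : Labelling n} (hχ : IsProperColoring χ)
    (k : ℕ) (hk : k < n - 3) :
    ∃ y : ℕ → ℤ, (∀ i < k, y (i + 1) = y i ∨ y (i + 1) = y i - 1) ∧
      ∀ i : Fin (n - 3), i.val ≤ k →
        (χ i).1 = s(((y i : ℤ) : ZMod n), ((y i + i.val + 2 : ℤ) : ZMod n)) := by
  induction k with
  | zero =>
    obtain ⟨a, ha⟩ := hχ.short_zero ⟨0, hk⟩ rfl
    obtain ⟨b, -, -, rfl⟩ := exists_cast_eq (n := n) (by omega) 0 a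
    refine ⟨fun _ => b - 1, by omega, fun i hi => ?_⟩
    obtain rfl : i = ⟨0, hk⟩ := Fin.ext (by simpa using hi)
    have e : (b : ZMod n) + 1 = b - 1 + 2 := by ring
    simp [ha, e]
  | succ k ih =>
    obtain ⟨y, hy, hχy⟩ := ih (by omega)
    obtain ⟨z, hz, hz'⟩ := exists_next hn hχ ⟨k, by omega⟩ ⟨k + 1, hk⟩ rfl (y k)
      (hχy ⟨k, by omega⟩ le_rfl) (fun i hi => ⟨y i, by
        have := hy i.val (by simp at hi; omega)
        simp only at hi
        rw [hi] at this
        omega, hχy i (by simp at hi; omega)⟩)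
    refine ⟨fun i => if i = k + 1 then z else y i, fun i hi => ?_, fun i hi => ?_⟩
    · rcases eq_or_ne i k with rfl | h
      · simpa using hz
      · simpa [h, show i ≠ k + 1 by omega] using hy i (by omega)
    · rcases eq_or_ne i.val (k + 1) with h | h
      · obtain rfl : i = ⟨k + 1, hk⟩ := Fin.ext h
        simpa using hz'
      · simpa [h] using hχy i (by omega)

theorem exists_lift {n : ℕ} (hn : 4 < n) {χ : Labelling n} (hχ : IsProperColoring χ) :
    ∃ y, Lifts y χ := by
  obtain ⟨y, hy, hχy⟩ := exists_lift_upto hn hχ (n - 4) (by omega)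
  refine ⟨fun i => y i, fun i j hij => ?_, fun i => hχy i (by omega)⟩
  have := hy i (by omega)
  rwa [← hij] at this

/-! ### Slope sequences describe proper colourings -/

/-- Nesting of the intervals `[y i, y i + i + 2]`: left ends move weakly left and right ends weakly
right as the label grows. Both the absence of crossings and the coordinatewise order come from these
two inequalities. -/
theorem IsSlope.le {m : ℕ} {y : Fin m → ℤ} (hy : IsSlope y) {i j : Fin m} (hij : i ≤ j) :
    y j ≤ y i ∧ y i + i.val ≤ y j + j.val := by
  obtain ⟨k, hk⟩ := Nat.exists_eq_add_of_le (Fin.le_def.mp hij)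
  induction k generalizing j with
  | zero =>
    obtain rfl : j = i := Fin.ext (by simpa using hk)
    omega
  | succ k ih =>
    have := j.isLt
    have h1 := ih (j := ⟨i.val + k, by omega⟩) (Fin.le_def.mpr (by simp)) rfl
    have h2 := hy ⟨i.val + k, by omega⟩ j (by simp; omega)
    simp only at h1
    omega

theorem Lifts.injective {n : ℕ} {y : Fin (n - 3) → ℤ} {χ : Labelling n} (h : Lifts y χ) :
    Function.Injective χ := by
  have key : ∀ i j : Fin (n - 3), i ≤ j → χ i = χ j → i = j := by
    intro i j hij he
    have h1 := h.1.le hij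
    have := j.isLt
    have he' : (χ i).1 = (χ j).1 := by rw [he]
    rw [h.2 i, h.2 j] at he'
    have := segment_eq (r := y j) (by omega) (by omega) (by omega) (by omega) (by omega)
      (by omega) he'
    exact Fin.ext (by omega)
  intro i j he
  rcases le_total i j with hij | hij
  · exact key i j hij he
  · exact (key j i hij he.symm).symm

theorem Lifts.not_crosses {n : ℕ} (hn : 4 < n) {y : Fin (n - 3) → ℤ} {χ : Labelling n}
    (h : Lifts y χ) (i j : Fin (n - 3)) : ¬ Crosses (χ i).1 (χ j).1 := by
  have key : ∀ i j : Fin (n - 3), i ≤ j → ¬ Crosses (χ i).1 (χ j).1 := by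
    intro i j hij
    have h1 := h.1.le hij
    have := j.isLt
    rw [h.2 i, h.2 j, crosses_cast_iff hn (r := y j) (by omega) (by omega) (by omega) (by omega)
      (by omega) (by omega)]
    omega
  rcases le_total i j with hij | hij
  · exact key i j hij
  · exact fun hc => key j i hij hc.symm

/-- The interval of chord `k + 1` has one vertex more than that of chord `k`. A segment inside it
that uses this vertex is either chord `k + 1` itself or crosses chord `k`; otherwise induction
applies. -/
theorem Lifts.exists_label {n : ℕ} (hn : 4 < n) {y : Fin (n - 3) → ℤ} {χ : Labelling n}
    (h : Lifts y χ) {u v : ℤ} (huv : u + 2 ≤ v)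
    (hcr : ∀ j, ¬ Crosses s((u : ZMod n), (v : ZMod n)) (χ j).1) (k : ℕ) (hk : k < n - 3)
    (hu : y ⟨k, hk⟩ ≤ u) (hv : v ≤ y ⟨k, hk⟩ + k + 2) :
    ∃ j, (χ j).1 = s((u : ZMod n), (v : ZMod n)) := by
  induction k with
  | zero =>
    refine ⟨⟨0, hk⟩, ?_⟩
    have e1 : y ⟨0, hk⟩ = u := by omega
    have e2 : u + ((0 : ℕ) : ℤ) + 2 = v := by omega
    rw [h.2, e1]
    simp only [e2]
  | succ k ih =>
    have hs := h.1 ⟨k, by omega⟩ ⟨k + 1, hk⟩ rfl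
    have hc := hcr ⟨k, by omega⟩
    have ih := ih (by omega)
    have hl := h.2 ⟨k + 1, hk⟩
    rw [h.2] at hc
    simp only at hc hl
    generalize y ⟨k, by omega⟩ = p at *
    generalize y ⟨k + 1, hk⟩ = q at *
    by_cases hin : p ≤ u ∧ v ≤ p + k + 2
    · exact ih hin.1 hin.2
    by_cases heq : u = q ∧ v = q + (k + 1 : ℕ) + 2
    · exact ⟨⟨k + 1, hk⟩, by rw [hl, heq.1, heq.2]⟩
    exfalso
    rw [crosses_cast_iff hn (r := q) (by omega) (by omega) (by omega) (by omega) (by omega)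
      (by omega)] at hc
    omega

theorem Lifts.isTriangulation {n : ℕ} (hn : 4 < n) {y : Fin (n - 3) → ℤ} {χ : Labelling n}
    (h : Lifts y χ) : IsTriangulation (Set.range χ) := by
  constructor
  · rintro _ ⟨i, rfl⟩ _ ⟨j, rfl⟩
    exact h.not_crosses hn i j
  · intro d hd
    have hl : n - 4 < n - 3 := by omega
    obtain ⟨u, v, hu, huv, hv, hvu, heq⟩ := d.exists_eq hn (y ⟨n - 4, hl⟩)
    have hcr : ∀ j, ¬ Crosses s((u : ZMod n), (v : ZMod n)) (χ j).1 := by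
      intro j
      rw [← heq]
      exact hd _ ⟨j, rfl⟩
    -- The last chord spans every vertex of the window except `y + n - 1`; a diagonal ending there
    -- crosses it.
    by_cases hv' : v ≤ y ⟨n - 4, hl⟩ + (n - 4 : ℕ) + 2
    · obtain ⟨j, hj⟩ := h.exists_label hn huv hcr (n - 4) hl hu hv'
      exact ⟨j, Subtype.ext (hj.trans heq.symm)⟩
    · exfalso
      have hc := hcr ⟨n - 4, hl⟩
      rw [h.2] at hc
      simp only at hc
      rw [crosses_cast_iff hn (r := y ⟨n - 4, hl⟩) (by omega) (by omega) (by omega) (by omega)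
        (by omega) (by omega)] at hc
      omega

theorem Lifts.eq_ends {n : ℕ} {y : Fin (n - 3) → ℤ} {χ : Labelling n} (h : Lifts y χ)
    {i : Fin (n - 3)} {a b : ZMod n} (hi : (χ i).1 = s(a, b)) :
    (a = (y i : ℤ) ∧ b = (y i + i.val + 2 : ℤ)) ∨ (b = (y i : ℤ) ∧ a = (y i + i.val + 2 : ℤ)) := by
  rw [h.2 i] at hi
  rcases Sym2.eq_iff.mp hi with ⟨h1, h2⟩ | ⟨h1, h2⟩
  · exact Or.inl ⟨h1.symm, h2.symm⟩
  · exact Or.inr ⟨h1.symm, h2.symm⟩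

/-- If `k` is the largest label, the other two chords would cut its interval into two pieces meeting
only at `c`, while intervals of different labels are nested. -/
theorem Lifts.not_triangle {n : ℕ} (hn : 4 < n) {y : Fin (n - 3) → ℤ} {χ : Labelling n}
    (h : Lifts y χ) {a b c : ZMod n} {i j k : Fin (n - 3)} (hik : i ≤ k) (hjk : j ≤ k)
    (hi : (χ i).1 = s(a, c)) (hj : (χ j).1 = s(b, c)) (hk : (χ k).1 = s(a, b))
    (hac : a ≠ c) (hbc : b ≠ c) : False := by
  have key : ∀ {a b c : ZMod n} {i j : Fin (n - 3)}, i ≤ k → j ≤ k →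
    (χ i).1 = s(a, c) → (χ j).1 = s(b, c) → a = (y k : ℤ) → b = (y k + k.val + 2 : ℤ) →
      a ≠ c → b ≠ c → False := by
    rintro _ _ c i j hik hjk hi hj rfl rfl hac hbc
    obtain ⟨z, hz, hz', rfl⟩ := exists_cast_eq (n := n) (by omega) (y k) c
    have h1 := h.1.le hik
    have h2 := h.1.le hjk
    have := k.isLt
    rw [h.2] at hi hj
    have hne : z ≠ y k := fun e => hac (by rw [e])
    have hne' : z ≠ y k + k.val + 2 := fun e => hbc (by rw [e])
    have h3 := segment_eq (r := y k) (by omega) (by omega) (by omega) (by omega) (by omega)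
      (by omega) hi
    rw [Sym2.eq_swap (a := ((y k + k.val + 2 : ℤ) : ZMod n))] at hj
    have h4 := segment_eq (r := y k) (by omega) (by omega) (by omega) (by omega) (by omega)
      (by omega) hj
    rcases le_total i j with hij | hij
    · have := h.1.le hij
      omega
    · have := h.1.le hij
      omega
  rcases h.eq_ends hk with ⟨ha, hb⟩ | ⟨hb, ha⟩
  · exact key hik hjk hi hj ha hb hac hbc
  · exact key hjk hik hj hi hb ha hbc hac

theorem Lifts.isTriangleFree {n : ℕ} (hn : 4 < n) {y : Fin (n - 3) → ℤ} {χ : Labelling n}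
    (h : Lifts y χ) : IsTriangleFree (Set.range χ) := by
  rintro a b c ⟨hab, hbc, hac, -⟩ ⟨⟨_, ⟨k, rfl⟩, hk⟩, ⟨_, ⟨i, rfl⟩, hi⟩, ⟨_, ⟨j, rfl⟩, hj⟩⟩
  have hk' := hk.trans Sym2.eq_swap
  have hi' := hi.trans Sym2.eq_swap
  have hj' := hj.trans Sym2.eq_swap
  rcases le_total i k with h1 | h1 <;> rcases le_total j k with h2 | h2 <;>
    rcases le_total i j with h3 | h3
  all_goals
    first
      | exact h.not_triangle hn ‹j ≤ k› ‹i ≤ k› hj hi hk hac hbc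
      | exact h.not_triangle hn (k := j) h1 ‹i ≤ j› hk hi' hj hab hbc.symm
      | exact h.not_triangle hn (k := j) (h1.trans h3) h3 hk hi' hj hab hbc.symm
      | exact h.not_triangle hn (k := j) h2 (h1.trans h2) hk hi' hj hab hbc.symm
      | exact h.not_triangle hn (k := i) h1 h3 hk' hj' hi hab.symm hac.symm

theorem Lifts.consecutive {n : ℕ} (hn : 4 < n) {y : Fin (n - 3) → ℤ} {χ : Labelling n}
    (h : Lifts y χ) {a b c : ZMod n} {i j : Fin (n - 3)} (hij : i ≤ j)
    (hi : (χ i).1 = s(a, b)) (hj : (χ j).1 = s(b, c)) (hab : a ≠ b) (hac : a ≠ c)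
    (hext : IsExternal s(a, c)) : i.val + 1 = j.val := by
  obtain ⟨z, hz, hz', rfl⟩ := exists_cast_eq (n := n) (by omega) (y j) a
  have h1 := h.1.le hij
  have := j.isLt
  rw [h.2] at hi
  rcases h.eq_ends hj with ⟨rfl, rfl⟩ | ⟨rfl, rfl⟩
  · have hne : z ≠ y j := fun e => hab (by rw [e])
    rw [Sym2.eq_swap (a := (z : ZMod n))] at hi
    have h3 := segment_eq (r := y j) (by omega) (by omega) (by omega) (by omega) (by omega)
      (by omega) hi
    have hne' : z ≠ y j + j.val + 2 := fun e => hac (by rw [e])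
    rw [isExternal_cast_iff hn (by omega) (by omega)] at hext
    omega
  · have hne : z ≠ y j + j.val + 2 := fun e => hab (by rw [e])
    have hne' : z ≠ y j := fun e => hac (by rw [e])
    rcases lt_or_gt_of_ne hne with hlt | hlt
    · have h3 := segment_eq (r := y j) (by omega) (by omega) (by omega) (by omega) (by omega)
        (by omega) hi
      rw [Sym2.eq_swap, isExternal_cast_iff hn (by omega) (by omega)] at hext
      omega
    · rw [Sym2.eq_swap (a := (z : ZMod n))] at hi
      have h3 := segment_eq (r := y j) (by omega) (by omega) (by omega) (by omega) (by omega)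
        (by omega) hi
      omega

theorem Lifts.isProperColoring {n : ℕ} (hn : 4 < n) {y : Fin (n - 3) → ℤ} {χ : Labelling n}
    (h : Lifts y χ) : IsProperColoring χ where
  injective := h.injective
  triangulation := h.isTriangulation hn
  triangleFree := h.isTriangleFree hn
  short_zero i hi := by
    refine ⟨((y i + 1 : ℤ) : ZMod n), ?_⟩
    rw [h.2 i, hi]
    have e : ((y i : ℤ) : ZMod n) + 1 + 1 = (y i : ℤ) + 2 := by ring
    simp [e]
  consecutive a b c i j ht hi hj hac := by
    obtain ⟨hab, hbc, hac', -, -, h3⟩ := ht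
    have hext := h3.resolve_left hac
    rcases le_total i j with hij | hij
    · exact Or.inl (h.consecutive hn hij hi hj hab hac' hext)
    · exact Or.inr (h.consecutive hn hij (hj.trans Sym2.eq_swap) (hi.trans Sym2.eq_swap)
        hbc.symm hac'.symm (by rwa [Sym2.eq_swap]))

theorem IsSlope.exists_lifts {n : ℕ} (hn : 4 < n) {y : Fin (n - 3) → ℤ} (hy : IsSlope y) :
    ∃ T : CTFT n, Lifts y T.1 := by
  have h : Lifts y fun i : Fin (n - 3) =>
      diagonalOf hn (y i) (y i + i.val + 2) (by omega) (by omega) := ⟨hy, fun i => rfl⟩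
  exact ⟨⟨_, h.isProperColoring hn⟩, h⟩

theorem Lifts.eq {n : ℕ} {y : Fin (n - 3) → ℤ} {T T' : CTFT n} (h : Lifts y T.1)
    (h' : Lifts y T'.1) : T = T' :=
  Subtype.ext (funext fun i => Subtype.ext ((h.2 i).trans (h'.2 i).symm))

/-! ### Flips of lifts -/

theorem Lifts.isFlip {n : ℕ} (hn : 4 < n) {y : Fin (n - 3) → ℤ} {T T' : CTFT n} {i : Fin (n - 3)}
    (h : Lifts y T.1) (h' : Lifts (Function.update y i (y i - 1)) T'.1) : IsFlip i T T' := by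
  have hlt := i.isLt
  have hint : IsInternalEdge (Set.range T.1)
      s(((y i : ℤ) : ZMod n), ((y i + i.val + 2 : ℤ) : ZMod n)) := ⟨T.1 i, ⟨i, rfl⟩, h.2 i⟩
  -- The slope conditions before and after the update together force chord `i - 1` to be `[y i, y i
  -- + i + 1]` and chord `i + 1` to be `[y i - 1, y i + i + 2]`. With chord `i` and two polygon
  -- sides they bound the quadrangle; at the extreme labels a polygon side takes the place of the
  -- missing chord.
  refine ⟨⟨(y i : ℤ), (y i + i.val + 1 : ℤ), (y i + i.val + 2 : ℤ), (y i - 1 : ℤ),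
    (cast_ne (by omega) (by omega)).symm,
    ⟨cast_ne (by omega) (by omega), cast_ne (by omega) (by omega), cast_ne (by omega) (by omega),
      ?_, Or.inr ((isExternal_cast_iff hn (by omega) (by omega)).mpr (by omega)), Or.inl hint⟩,
    ⟨(cast_ne (by omega) (by omega)).symm, cast_ne (by omega) (by omega),
      cast_ne (by omega) (by omega), Or.inr ?_, ?_, Or.inl hint⟩, h.2 i, ?_⟩, fun j hj => ?_⟩
  · by_cases h0 : i.val = 0
    · exact Or.inr ((isExternal_cast_iff hn (by omega) (by omega)).mpr (by omega))
    · left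
      obtain ⟨j, hj⟩ : ∃ j : Fin (n - 3), i.val = j.val + 1 :=
        ⟨⟨i.val - 1, by omega⟩, by simp; omega⟩
      refine ⟨T.1 j, ⟨j, rfl⟩, ?_⟩
      have h1 := h.1 j i hj
      have h2 := h'.1 j i hj
      rw [Function.update_self, Function.update_of_ne (by rintro rfl; omega)] at h2
      have e : y j = y i := by omega
      have e' : y i + j.val + 2 = y i + i.val + 1 := by omega
      rw [h.2 j, e, e']
  · rw [Sym2.eq_swap, isExternal_cast_iff hn (by omega) (by omega)]
    omega
  · by_cases h0 : i.val + 1 = n - 3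
    · exact Or.inr ((isExternal_cast_iff hn (by omega) (by omega)).mpr (by omega))
    · left
      obtain ⟨j, hj⟩ : ∃ j : Fin (n - 3), j.val = i.val + 1 := ⟨⟨i.val + 1, by omega⟩, rfl⟩
      refine ⟨T.1 j, ⟨j, rfl⟩, ?_⟩
      have h1 := h.1 i j hj
      have h2 := h'.1 i j hj
      rw [Function.update_self, Function.update_of_ne (by rintro rfl; omega)] at h2
      have e : y j = y i - 1 := by omega
      have e' : y i - 1 + j.val + 2 = y i + i.val + 2 := by omega
      rw [h.2 j, e, e']
  · have e : y i - 1 + i.val + 2 = y i + i.val + 1 := by ring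
    rw [h'.2 i, Function.update_self, Sym2.eq_swap, e]
  · refine Subtype.ext ?_
    rw [h'.2 j, h.2 j, Function.update_of_ne hj]

/-- The second alternative is the same chord read from its other end, possible only for a diameter,
when `n ∣ 2 * (k + 2)`. -/
theorem chord_cases {n : ℕ} {k : ℕ} {a b : ℤ}
    (h : s((a : ZMod n), ((a + k + 2 : ℤ) : ZMod n)) =
      s((b : ZMod n), ((b + k + 2 : ℤ) : ZMod n))) :
    (n : ℤ) ∣ b - a ∨ ((n : ℤ) ∣ b - a + k + 2 ∧ (n : ℤ) ∣ b - a - k - 2) := by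
  rcases Sym2.eq_iff.mp h with ⟨h1, -⟩ | ⟨h1, h2⟩
  · exact Or.inl ((ZMod.intCast_eq_intCast_iff_dvd_sub _ _ _).mp h1)
  · right
    rw [ZMod.intCast_eq_intCast_iff_dvd_sub] at h1 h2
    constructor
    · convert h1 using 1
      ring
    · convert h2 using 1
      ring

theorem eq_zero_of_dvd {n : ℕ} {d : ℤ} (h : (n : ℤ) ∣ d) (h1 : -n < d) (h2 : d < n) : d = 0 :=
  Int.eq_zero_of_abs_lt_dvd h (abs_lt.mpr ⟨h1, h2⟩)

/-- Reading from the other end would give `n ∣ 2 * (b - a)`; since `|2 * (b - a)| ≤ 4 < n` this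
means `b = a`, and then `n ∣ k + 2`, which is too small. -/
theorem chord_eq_of_close {n : ℕ} (hn : 4 < n) {k : ℕ} (hk : k < n - 3) {a b : ℤ}
    (h : s((a : ZMod n), ((a + k + 2 : ℤ) : ZMod n)) =
      s((b : ZMod n), ((b + k + 2 : ℤ) : ZMod n))) (h1 : b - a ≤ 2) (h2 : a - b ≤ 2) : b = a := by
  rcases chord_cases h with h | ⟨h3, h4⟩
  · have := eq_zero_of_dvd h (by omega) (by omega)
    omega
  · exfalso
    by_cases hd : b - a + k + 2 < n
    · have := eq_zero_of_dvd h3 (by omega) (by omega)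
      have := eq_zero_of_dvd h4 (by omega) (by omega)
      omega
    · have e : b - a + k + 2 - n = 0 :=
        eq_zero_of_dvd (Int.dvd_sub h3 dvd_rfl) (by omega) (by omega)
      by_cases hd' : -n < b - a - k - 2
      · have := eq_zero_of_dvd h4 (by omega) (by omega)
        omega
      · have := eq_zero_of_dvd (Int.dvd_add h4 dvd_rfl) (by omega) (by omega)
        omega

theorem Lifts.add_mul {n : ℕ} {y : Fin (n - 3) → ℤ} {χ : Labelling n} (h : Lifts y χ) (t : ℤ) :
    Lifts (fun i => y i + n * t) χ := by
  refine ⟨fun i j hij => ?_, fun i => ?_⟩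
  · have := h.1 i j hij
    simp only
    omega
  · rw [h.2 i]
    push_cast
    simp

/-- Lifts of labellings that agree off `i` are equal off `i` and close at `i`, up to a common
translation. -/
theorem Lifts.close {n : ℕ} (hn : 4 < n) {y y' : Fin (n - 3) → ℤ} {χ χ' : Labelling n}
    (h : Lifts y χ) (h' : Lifts y' χ') (i : Fin (n - 3)) (hij : ∀ j ≠ i, χ' j = χ j) :
    ∃ t : ℤ, (∀ j ≠ i, y' j + n * t = y j) ∧ y' i + n * t - y i ≤ 1 ∧ y i - (y' i + n * t) ≤ 1 := by
  have hch : ∀ (j : Fin (n - 3)) (_ : j ≠ i),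
      s(((y j : ℤ) : ZMod n), ((y j + j.val + 2 : ℤ) : ZMod n)) =
        s(((y' j : ℤ) : ZMod n), ((y' j + j.val + 2 : ℤ) : ZMod n)) := by
    intro j hj
    rw [← h.2 j, ← h'.2 j, hij j hj]
  suffices ∃ t : ℤ, ∀ j, (j ≠ i → y' j + n * t = y j) ∧ y' j + n * t - y j ≤ 1 ∧
      y j - (y' j + n * t) ≤ 1 by
    obtain ⟨t, ht⟩ := this
    exact ⟨t, fun j hj => (ht j).1 hj, (ht i).2⟩
  -- The extreme labels `0` and `n - 4` carry short chords, never diameters as `n > 4`, so there the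
  -- starting point is determined modulo `n`. One of them differs from `i` and fixes the translation
  -- `t`; the slope conditions carry it to the other labels.
  have hstart : ∀ j : Fin (n - 3), j ≠ i → (j.val = 0 ∨ j.val = n - 4) →
      ∃ t : ℤ, y' j + n * t = y j := by
    intro j hj h0
    have hd : (n : ℤ) ∣ y' j - y j := by
      rcases chord_cases (hch j hj) with hd | ⟨h3, h4⟩
      · exact hd
      · exfalso
        have h5 : (n : ℤ) ∣ 2 * (j.val + 2) := by
          convert Int.dvd_sub h3 h4 using 1
          ring
        rcases h0 with h0 | h0
        · have := eq_zero_of_dvd h5 (by omega) (by omega)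
          omega
        · have := eq_zero_of_dvd (Int.dvd_sub h5 dvd_rfl) (by omega) (by omega)
          omega
    obtain ⟨t, ht⟩ := hd
    exact ⟨-t, by rw [mul_neg]; omega⟩
  by_cases hi : i.val = 0
  · obtain ⟨t, ht⟩ := hstart ⟨n - 4, by omega⟩ (by
      intro e
      rw [← e] at hi
      simp only at hi
      omega) (Or.inr rfl)
    refine ⟨t, ?_⟩
    have h'' := h'.add_mul t
    have hch' : ∀ j : Fin (n - 3), j ≠ i → y' j + n * t - y j ≤ 2 → y j - (y' j + n * t) ≤ 2 →
        y' j + n * t = y j := by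
      intro j hj
      refine chord_eq_of_close hn j.isLt ?_
      rw [← h.2 j, ← h''.2 j, hij j hj]
    have key : ∀ k, ∀ j : Fin (n - 3), j.val + k = n - 4 → (j ≠ i → y' j + n * t = y j) ∧
        y' j + n * t - y j ≤ 1 ∧ y j - (y' j + n * t) ≤ 1 := by
      intro k
      induction k with
      | zero =>
        intro j hj
        have e : j = ⟨n - 4, by omega⟩ := Fin.ext (by simpa using hj)
        rw [e]
        omega
      | succ k ih =>
        intro j hj
        have hl : j.val + 1 < n - 3 := by omega
        have h1 := (ih ⟨j.val + 1, hl⟩ (by simp; omega)).1 (by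
          intro e
          rw [← e] at hi
          simp at hi)
        have h2 := h.1 j ⟨j.val + 1, hl⟩ rfl
        have h3 := h''.1 j ⟨j.val + 1, hl⟩ rfl
        simp only at h3
        refine ⟨fun hji => hch' j hji (by omega) (by omega), by omega, by omega⟩
    exact fun j => key (n - 4 - j.val) j (by omega)
  · obtain ⟨t, ht⟩ := hstart ⟨0, by omega⟩ (by
      intro e
      rw [← e] at hi
      simp at hi) (Or.inl rfl)
    refine ⟨t, ?_⟩
    have h'' := h'.add_mul t
    -- Tolerance `2`: the entry at `i` may be off by one, and the slope step past it can add one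
    -- more.
    have hch' : ∀ j : Fin (n - 3), j ≠ i → y' j + n * t - y j ≤ 2 → y j - (y' j + n * t) ≤ 2 →
        y' j + n * t = y j := by
      intro j hj
      refine chord_eq_of_close hn j.isLt ?_
      rw [← h.2 j, ← h''.2 j, hij j hj]
    have key : ∀ k, ∀ j : Fin (n - 3), j.val = k → (j ≠ i → y' j + n * t = y j) ∧
        y' j + n * t - y j ≤ 1 ∧ y j - (y' j + n * t) ≤ 1 := by
      intro k
      induction k with
      | zero =>
        intro j hj
        have e : j = ⟨0, by omega⟩ := Fin.ext (by simpa using hj)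
        rw [e]
        omega
      | succ k ih =>
        intro j hj
        have hl : k < n - 3 := by omega
        have h1 := ih ⟨k, hl⟩ rfl
        have h2 := h.1 ⟨k, hl⟩ j hj
        have h3 := h''.1 ⟨k, hl⟩ j hj
        simp only at h3
        by_cases hji : j = i
        · have h4 := h1.1 (by
            intro e
            have := congrArg Fin.val (hji.trans e.symm)
            simp only at this
            omega)
          exact ⟨fun h => absurd hji h, by omega, by omega⟩
        · have := hch' j hji (by omega) (by omega)
          exact ⟨fun _ => this, by omega, by omega⟩
    exact fun j => key j.val j rfl

theorem Lifts.unique {n : ℕ} (hn : 4 < n) {y y' : Fin (n - 3) → ℤ} {χ : Labelling n}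
    (h : Lifts y χ) (h' : Lifts y' χ) : ∃ t : ℤ, ∀ j, y' j + n * t = y j := by
  obtain ⟨t, h1, h2, h3⟩ := h.close hn h' ⟨0, by omega⟩ fun _ _ => rfl
  refine ⟨t, fun j => ?_⟩
  by_cases hj : j = ⟨0, by omega⟩
  · subst hj
    refine chord_eq_of_close hn (k := 0) (by omega) ?_ (by omega) (by omega)
    exact (h.2 _).symm.trans ((h'.add_mul t).2 _)
  · exact h1 j hj

/-- Only the unchanged labels are used: they leave entry `i` free by at most one in each direction,
and no change is excluded since a flip never fixes a triangulation. -/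
theorem Lifts.exists_of_isFlip {n : ℕ} (hn : 4 < n) {y : Fin (n - 3) → ℤ} {T T' : CTFT n}
    {i : Fin (n - 3)} (h : Lifts y T.1) (hf : IsFlip i T T') :
    ∃ δ : ℤ, (δ = 1 ∨ δ = -1) ∧ Lifts (Function.update y i (y i + δ)) T'.1 := by
  obtain ⟨y', h'⟩ := exists_lift hn T'.2
  obtain ⟨t, h1, h2, h3⟩ := h.close hn h' i hf.2
  have h'' := h'.add_mul t
  have e : (fun j => y' j + n * t) = Function.update y i (y i + (y' i + n * t - y i)) := by
    funext j
    by_cases hj : j = i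
    · subst hj
      rw [Function.update_self]
      ring
    · rw [Function.update_of_ne hj, h1 j hj]
  rw [e] at h''
  refine ⟨_, ?_, h''⟩
  have hne : y' i + n * t - y i ≠ 0 := by
    intro h0
    rw [h0, add_zero, Function.update_eq_self] at h''
    exact hf.ne (h.eq h'')
  omega

/-! ### Lifts of the two stars -/

theorem lifts_star {n : ℕ} (hn : 4 < n) : Lifts 0 (star n hn).1 := by
  refine ⟨fun i j _ => Or.inl rfl, fun i => ?_⟩
  change s(0, ((i.val + 2 : ℕ) : ZMod n)) = _
  simp

theorem lifts_starReverse {n : ℕ} (hn : 4 < n) :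
    Lifts (fun i => (n : ℤ) - 2 - i.val) (starReverse n hn).1 := by
  refine ⟨fun i j hij => ?_, fun i => ?_⟩
  · simp only
    omega
  · change s(0, ((i.rev.val + 2 : ℕ) : ZMod n)) = _
    have hi := i.isLt
    have e1 : ((i.rev.val + 2 : ℕ) : ZMod n) = (((n : ℤ) - 2 - i.val : ℤ) : ZMod n) := by
      rw [← Int.cast_natCast]
      congr 1
      rw [Fin.val_rev]
      omega
    have e2 : (0 : ZMod n) = (((n : ℤ) - 2 - i.val + i.val + 2 : ℤ) : ZMod n) := by
      simp
    rw [e1, Sym2.eq_swap, ← e2]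

/-! ### The two orientations -/

/-- The sign of an orientation. -/
def sgn (ε : Bool) : ℤ := if ε then 1 else -1

/-- The reindexing of an orientation: the identity or the reversal. -/
def reindex {m : ℕ} (ε : Bool) (i : Fin m) : Fin m := if ε then i else i.rev

/-- The action of an orientation on sequences. -/
def orient {m : ℕ} (ε : Bool) (Z : Fin m → ℤ) : Fin m → ℤ := fun i => sgn ε * Z (reindex ε i)

/-- The vertex ranks `0 < 1 < … < n - 1` or `0 < n - 1 < … < 1`. -/
def orientedRank {n : ℕ} (ε : Bool) (a : ZMod n) : ℕ := (((sgn ε : ℤ) : ZMod n) * a).val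

theorem sgn_mul_self (ε : Bool) : sgn ε * sgn ε = 1 := by
  cases ε <;> rfl

theorem sgn_mul_cancel (ε : Bool) (a : ℤ) : sgn ε * (sgn ε * a) = a := by
  rw [← mul_assoc, sgn_mul_self, one_mul]

theorem reindex_reindex {m : ℕ} (ε : Bool) (i : Fin m) : reindex ε (reindex ε i) = i := by
  cases ε <;> simp [reindex]

theorem orient_apply_reindex {m : ℕ} (ε : Bool) (Z : Fin m → ℤ) (i : Fin m) :
    orient ε Z (reindex ε i) = sgn ε * Z i := by
  rw [orient, reindex_reindex]

theorem orient_orient {m : ℕ} (ε : Bool) (Z : Fin m → ℤ) : orient ε (orient ε Z) = Z := by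
  funext i
  rw [orient, orient_apply_reindex, sgn_mul_cancel]

theorem orient_update {m : ℕ} (ε : Bool) (Z : Fin m → ℤ) (i : Fin m) (v : ℤ) :
    orient ε (Function.update Z i v) =
      Function.update (orient ε Z) (reindex ε i) (sgn ε * v) := by
  funext j
  by_cases h : j = reindex ε i
  · subst h
    rw [orient_apply_reindex, Function.update_self, Function.update_self]
  · rw [Function.update_of_ne h, orient, orient, Function.update_of_ne]
    rintro rfl
    exact h (reindex_reindex _ _).symm

/-- Negation turns steps `0, -1` into `0, 1`, and reversing the index turns them back. -/
theorem IsSlope.orient {m : ℕ} {Z : Fin m → ℤ} (hZ : IsSlope Z) (ε : Bool) :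
    IsSlope (orient ε Z) := by
  intro i j hij
  cases ε
  · have hi := i.isLt
    have hj := j.isLt
    have := hZ j.rev i.rev (by rw [Fin.val_rev, Fin.val_rev]; omega)
    simp only [FlipGraph.orient, sgn, reindex, Bool.false_eq_true, if_false]
    omega
  · have := hZ i j hij
    simp only [FlipGraph.orient, sgn, reindex, if_true]
    omega

theorem IsSlope.of_orient {m : ℕ} {Z : Fin m → ℤ} {ε : Bool} (hZ : IsSlope (FlipGraph.orient ε Z)) :
    IsSlope Z := by
  have := hZ.orient ε
  rwa [orient_orient] at this

/-- For `ε = false` the chord labelled `n - 4 - i` starts at `-Z i` and ends at `n - (Z i + i + 2)`: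
it is the mirror image of the chord that `Z` would assign to `i`. -/
theorem Lifts.chord_reindex {n : ℕ} {ε : Bool} {Z : Fin (n - 3) → ℤ} {χ : Labelling n}
    (h : Lifts (orient ε Z) χ) (i : Fin (n - 3)) :
    (χ (reindex ε i)).1 = s(((sgn ε * Z i : ℤ) : ZMod n),
      ((sgn ε * (Z i + i.val + 2) : ℤ) : ZMod n)) := by
  rw [h.2, orient_apply_reindex]
  cases ε
  · have hi := i.isLt
    have e : sgn false * Z i + ((reindex false i).val : ℤ) + 2 =
        sgn false * (Z i + i.val + 2) + n := by
      simp only [sgn, reindex, Bool.false_eq_true, if_false, Fin.val_rev]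
      omega
    rw [e, cast_add_self]
  · simp [sgn, reindex]

theorem orientedRank_cast {n : ℕ} (ε : Bool) {a : ℕ} (ha : a < n) :
    orientedRank ε (((sgn ε * a : ℤ)) : ZMod n) = a := by
  rw [orientedRank, ← Int.cast_mul, sgn_mul_cancel, Int.cast_natCast, val_natCast ha]

theorem orientedRank_true {n : ℕ} : (orientedRank true : ZMod n → ℕ) = naturalRank := by
  funext a
  simp [orientedRank, naturalRank, sgn]

theorem orientedRank_false {n : ℕ} : (orientedRank false : ZMod n → ℕ) = reversedRank := by
  funext a
  simp [orientedRank, reversedRank, sgn]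

/-! ### Coordinates of diagonals -/

/-- The smaller rank of the ends of a diagonal. -/
def Diagonal.lo {n : ℕ} (ε : Bool) (d : Diagonal n) : ℕ := (d.1.map (orientedRank ε)).inf

/-- The larger rank of the ends of a diagonal. -/
def Diagonal.hi {n : ℕ} (ε : Bool) (d : Diagonal n) : ℕ := (d.1.map (orientedRank ε)).sup

theorem Diagonal.lo_hi_eq {n : ℕ} {ε : Bool} {d : Diagonal n} {a b : ℕ} (hab : a < b) (hb : b < n)
    (h : d.1 = s(((sgn ε * a : ℤ) : ZMod n), ((sgn ε * b : ℤ) : ZMod n))) :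
    d.lo ε = a ∧ d.hi ε = b := by
  rw [Diagonal.lo, Diagonal.hi, h, Sym2.map_mk, orientedRank_cast ε (by omega),
    orientedRank_cast ε hb]
  simp [hab.le]

theorem Diagonal.spec {n : ℕ} (hn : 4 < n) (ε : Bool) (d : Diagonal n) :
    d.lo ε + 2 ≤ d.hi ε ∧ d.hi ε < n ∧ d.hi ε + 2 ≤ d.lo ε + n ∧
      d.1 = s(((sgn ε * d.lo ε : ℤ) : ZMod n), ((sgn ε * d.hi ε : ℤ) : ZMod n)) := by
  suffices ∃ a b : ℕ, a + 2 ≤ b ∧ b < n ∧ b + 2 ≤ a + n ∧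
      d.1 = s(((sgn ε * a : ℤ) : ZMod n), ((sgn ε * b : ℤ) : ZMod n)) by
    obtain ⟨a, b, h1, h2, h3, h4⟩ := this
    obtain ⟨e1, e2⟩ := Diagonal.lo_hi_eq (by omega) h2 h4
    rw [e1, e2]
    exact ⟨h1, h2, h3, h4⟩
  cases ε
  · obtain ⟨a, b, h1, h2, h3, h4, h⟩ := d.exists_eq hn (-n + 1)
    refine ⟨(-b).toNat, (-a).toNat, by omega, by omega, by omega, ?_⟩
    have ea : sgn false * ((-a).toNat : ℤ) = a := by
      simp only [sgn, Bool.false_eq_true, if_false]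
      omega
    have eb : sgn false * ((-b).toNat : ℤ) = b := by
      simp only [sgn, Bool.false_eq_true, if_false]
      omega
    rw [ea, eb, h, Sym2.eq_swap]
  · obtain ⟨a, b, h1, h2, h3, h4, h⟩ := d.exists_eq hn 0
    refine ⟨a.toNat, b.toNat, by omega, by omega, by omega, ?_⟩
    have ea : sgn true * (a.toNat : ℤ) = a := by simp only [sgn, if_true]; omega
    have eb : sgn true * (b.toNat : ℤ) = b := by simp only [sgn, if_true]; omega
    rw [ea, eb, h]

theorem Diagonal.eq_of_lo_hi {n : ℕ} (hn : 4 < n) {ε : Bool} {d e : Diagonal n}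
    (h1 : d.lo ε = e.lo ε) (h2 : d.hi ε = e.hi ε) : d = e := by
  refine Subtype.ext ?_
  rw [(d.spec hn ε).2.2.2, (e.spec hn ε).2.2.2, h1, h2]

theorem Diagonal.exists_lo_hi {n : ℕ} (hn : 4 < n) (ε : Bool) {a b : ℕ} (h1 : a + 2 ≤ b)
    (h2 : b < n) (h3 : b + 2 ≤ a + n) : ∃ d : Diagonal n, d.lo ε = a ∧ d.hi ε = b := by
  cases ε
  · let d := diagonalOf hn (-b) (-a) (by omega) (by omega)
    refine ⟨d, Diagonal.lo_hi_eq (by omega) h2 ?_⟩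
    simp only [sgn, Bool.false_eq_true, if_false, neg_mul, one_mul]
    exact Sym2.eq_swap
  · let d := diagonalOf hn a b (by omega) (by omega)
    refine ⟨d, Diagonal.lo_hi_eq (by omega) h2 ?_⟩
    simp only [sgn, if_true, one_mul]
    rfl

/-! ### Lifts of walks -/

theorem exists_lift_walk {n : ℕ} (hn : 4 < n) {T T' : CTFT n} (p : (Gamma n).Walk T T')
    {y : Fin (n - 3) → ℤ} (hy : Lifts y T.1) :
    ∃ Y : ℕ → Fin (n - 3) → ℤ, Y 0 = y ∧ (∀ k ≤ p.length, Lifts (Y k) (p.getVert k).1) ∧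
      ∀ k < p.length, ∃ i, ∃ δ : ℤ, (δ = 1 ∨ δ = -1) ∧
        Y (k + 1) = Function.update (Y k) i (Y k i + δ) ∧
        IsFlip i (p.getVert k) (p.getVert (k + 1)) := by
  induction p generalizing y with
  | nil => exact ⟨fun _ => y, rfl, fun k _ => by simpa using hy, by simp⟩
  | cons h p ih =>
    obtain ⟨i, hi⟩ := id h
    obtain ⟨δ, hδ, hy'⟩ := hy.exists_of_isFlip hn hi
    obtain ⟨Y, h0, h1, h2⟩ := ih hy'
    refine ⟨fun k => k.casesOn y Y, rfl, fun k hk => ?_, fun k hk => ?_⟩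
    · cases k with
      | zero => simpa using hy
      | succ k => simpa using h1 k (by simpa using hk)
    · cases k with
      | zero => exact ⟨i, δ, hδ, h0, by simpa using hi⟩
      | succ k => simpa using h2 k (by simpa using hk)

/-- `Z` lifts the walk `p`, up to orientation, and each step of `p` increases one entry. -/
structure IsMonotoneLift {n : ℕ} (ε : Bool) {T T' : CTFT n} (p : (Gamma n).Walk T T')
    (Z : ℕ → Fin (n - 3) → ℤ) : Prop where
  zero : Z 0 = 0
  lifts : ∀ k ≤ p.length, Lifts (orient ε (Z k)) (p.getVert k).1
  step : ∀ k < p.length, ∃ i, Z (k + 1) = Function.update (Z k) i (Z k i + 1) ∧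
    IsFlip (reindex ε i) (p.getVert k) (p.getVert (k + 1))
  last : ∀ i, Z p.length i = (n : ℤ) - 2 - i.val

/-! ### Length of walks between the two stars -/

theorem sum_update_add {m : ℕ} (f : Fin m → ℤ) (i : Fin m) (v : ℤ) :
    ∑ j, Function.update f i (f i + v) j = ∑ j, f j + v := by
  have e : Function.update f i (f i + v) = f + Pi.single i v := by
    funext j
    by_cases h : j = i
    · subst h
      simp
    · simp [h]
  simp [e, Finset.sum_add_distrib]

theorem two_mul_sum_sub {n : ℕ} (hn : 4 < n) :
    2 * ∑ i : Fin (n - 3), ((n : ℤ) - 2 - i.val) = n * (n - 3) := by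
  have h : ∑ i : Fin (n - 3), ((n : ℤ) - 2 - i.val) = ∑ i : Fin (n - 3), ((i.val : ℤ) + 2) := by
    refine Fintype.sum_equiv Fin.revPerm _ _ fun i => ?_
    have := i.isLt
    rw [Fin.revPerm_apply, Fin.val_rev]
    omega
  rw [two_mul]
  nth_rewrite 2 [h]
  have e : ((n - 3 : ℕ) : ℤ) = n - 3 := by omega
  have e' : ∀ i : Fin (n - 3), ((n : ℤ) - 2 - i.val) + (i.val + 2) = n := fun i => by ring
  rw [← Finset.sum_add_distrib, Finset.sum_congr rfl fun i _ => e' i, Finset.sum_const,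
    Finset.card_univ, Fintype.card_fin, nsmul_eq_mul, e, mul_comm]

/-- The sum of the entries is a potential that moves by one at each step and must travel from `0` to
an odd multiple of `n(n-3)/2`. Minimal length leaves only the multiples `1` and `-1` and no backward
step. -/
theorem walk_length {n : ℕ} (hn : 4 < n)
    (p : (Gamma n).Walk (star n hn) (starReverse n hn)) :
    n * (n - 3) ≤ 2 * p.length ∧
      (2 * p.length ≤ n * (n - 3) → ∃ ε Z, IsMonotoneLift ε p Z) := by
  obtain ⟨Y, h0, hl, hs⟩ := exists_lift_walk hn p (lifts_star hn)
  obtain ⟨t, ht⟩ := (hl p.length le_rfl).unique hn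
    (by rw [SimpleGraph.Walk.getVert_length]; exact lifts_starReverse hn)
  have hsum : 2 * ∑ j, Y p.length j = n * (n - 3) * (1 + 2 * t) := by
    rw [← Finset.sum_congr rfl fun j _ => ht j, Finset.sum_add_distrib, mul_add,
      two_mul_sum_sub hn]
    have e : ((n - 3 : ℕ) : ℤ) = n - 3 := by omega
    simp [e]
    ring
  have hpos : (0 : ℤ) < n * (n - 3) := by
    have : (0 : ℤ) < n - 3 := by omega
    positivity
  have hcast : ((n * (n - 3) : ℕ) : ℤ) = n * (n - 3) := by
    rw [Nat.cast_mul, Nat.cast_sub (by omega)]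
    rfl
  -- `ε` is the sign of `1 + 2 * t`, and `1 + 2 * u` is its absolute value; `u = 0` corresponds to
  -- `t = 0` or `t = -1`.
  obtain ⟨ε, u, hu, hend, hlast⟩ : ∃ ε : Bool, ∃ u : ℤ, 0 ≤ u ∧
      2 * (sgn ε * ∑ j, Y p.length j) = n * (n - 3) * (1 + 2 * u) ∧
      (u = 0 → ∀ i, orient ε (Y p.length) i = (n : ℤ) - 2 - i.val) := by
    rcases le_or_gt 0 t with h | h
    · refine ⟨true, t, h, by simpa [sgn] using hsum, ?_⟩
      rintro rfl i
      simp only [orient, sgn, reindex, if_true, ← ht]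
      ring
    · refine ⟨false, -1 - t, by omega, ?_, ?_⟩
      · simp only [sgn, Bool.false_eq_true, if_false]
        linear_combination -hsum
      · intro h0 i
        have hi := i.isLt
        obtain rfl : t = -1 := by omega
        simp only [orient, sgn, reindex, Bool.false_eq_true, if_false, ← ht, Fin.val_rev]
        omega
  have hinc : ∀ k < p.length, ∃ i, ∃ δ : ℤ, (δ = 1 ∨ δ = -1) ∧
      Y (k + 1) = Function.update (Y k) i (Y k i + sgn ε * δ) ∧
      IsFlip i (p.getVert k) (p.getVert (k + 1)) := by
    intro k hk
    obtain ⟨i, δ, hδ, h1, h2⟩ := hs k hk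
    refine ⟨i, sgn ε * δ, ?_, by rwa [sgn_mul_cancel], h2⟩
    cases ε <;> simp only [sgn] <;> simp <;> omega
  set F : ℕ → ℤ := fun k => sgn ε * ∑ j, Y k j with hF
  have hF0 : F 0 = 0 := by simp [hF, h0]
  have hF1 : ∀ a b, a + b ≤ p.length → F (a + b) ≤ F a + b := by
    intro a b
    induction b with
    | zero => simp
    | succ b ih =>
      intro hb
      obtain ⟨i, δ, hδ, h1, -⟩ := hinc (a + b) (by omega)
      have h2 := ih (by omega)
      have h3 : F (a + (b + 1)) = F (a + b) + δ := by
        simp only [hF, ← add_assoc, h1, sum_update_add, mul_add, sgn_mul_cancel]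
      push_cast
      omega
  have hFL := hF1 0 p.length (by omega)
  rw [zero_add, hF0, zero_add] at hFL
  change 2 * F p.length = _ at hend
  have hnu : 0 ≤ n * (n - 3) * u := by positivity
  constructor
  · zify [show 3 ≤ n by omega]
    nlinarith
  · intro hle
    zify [show 3 ≤ n by omega] at hle
    have hu0 : u = 0 := by
      by_contra hne
      have : 1 ≤ u := by omega
      nlinarith
    subst hu0
    have hFL' : F p.length = p.length := by
      nlinarith
    refine ⟨ε, fun k => orient ε (Y k), ?_, fun k hk => ?_, fun k hk => ?_, hlast rfl⟩
    · funext i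
      simp [orient, h0]
    · rw [orient_orient]
      exact hl k hk
    · obtain ⟨i, δ, hδ, h1, h2⟩ := hinc k hk
      have h3 : F (k + 1) = F k + δ := by
        simp only [hF, h1, sum_update_add, mul_add, sgn_mul_cancel]
      -- `F` gains at most `k` before this step and at most `p.length - (k + 1)` after it, so a
      -- total gain of `p.length` forces `δ = 1`.
      have h4 := hF1 0 k (by omega)
      have h5 := hF1 (k + 1) (p.length - (k + 1)) (by omega)
      rw [Nat.add_sub_cancel' (by omega)] at h5
      rw [zero_add] at h4
      have hδ1 : δ = 1 := by omega
      subst hδ1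
      refine ⟨reindex ε i, ?_, by rwa [reindex_reindex]⟩
      rw [h1, orient_update, orient_apply_reindex, mul_add, sgn_mul_cancel]

/-! ### Flip times along a monotone lift -/

theorem IsFlip.label_unique {n : ℕ} {T T' : CTFT n} {i j : Fin (n - 3)} (h : IsFlip i T T')
    (h' : IsFlip j T T') : i = j := by
  by_contra hij
  refine h.ne (Subtype.ext (funext fun k => ?_))
  by_cases hk : k = i
  · exact (h'.2 k (by rwa [hk])).symm
  · exact (h.2 k hk).symm

/-- The label of a diagonal along a walk with monotone lift. -/
def Diagonal.label {n : ℕ} (hn : 4 < n) (ε : Bool) (d : Diagonal n) : Fin (n - 3) :=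
  ⟨d.hi ε - d.lo ε - 2, by
    have := d.spec hn ε
    omega⟩

theorem Diagonal.hi_eq {n : ℕ} (hn : 4 < n) (ε : Bool) (d : Diagonal n) :
    d.hi ε = d.lo ε + (d.label hn ε).val + 2 := by
  have := d.spec hn ε
  rw [Diagonal.label]
  simp only
  omega

/-- A sequence of integers increasing by unit steps or constant crosses every level once. -/
theorem exists_crossing_time {f : ℕ → ℤ} {L : ℕ} {c : ℤ} (h0 : f 0 ≤ c) (hL : c < f L)
    (hf : ∀ k < L, f k ≤ f (k + 1)) : ∃ t < L, ∀ k ≤ L, c < f k ↔ t < k := by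
  classical
  have hmono : ∀ a b, a + b ≤ L → f a ≤ f (a + b) := by
    intro a b
    induction b with
    | zero => simp
    | succ b ih =>
      intro hb
      exact (ih (by omega)).trans (hf (a + b) (by omega))
  have hex : ∃ k, c < f k := ⟨L, hL⟩
  have h1 := Nat.find_spec hex
  have h2 : Nat.find hex ≤ L := Nat.find_min' hex hL
  have h3 : Nat.find hex ≠ 0 := by
    intro h
    rw [h] at h1
    omega
  refine ⟨Nat.find hex - 1, by omega, fun k hk => ⟨fun h => ?_, fun h => ?_⟩⟩
  · have := Nat.find_min' hex h
    omega
  · have := hmono (Nat.find hex) (k - Nat.find hex) (by omega)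
    rw [Nat.add_sub_cancel' (by omega)] at this
    omega

section MonotoneLift

variable {n : ℕ} {ε : Bool} {T T' : CTFT n} {p : (Gamma n).Walk T T'}
  {Z : ℕ → Fin (n - 3) → ℤ}

theorem IsMonotoneLift.le_succ (h : IsMonotoneLift ε p Z) {k : ℕ} (hk : k < p.length)
    (j : Fin (n - 3)) : Z k j ≤ Z (k + 1) j := by
  obtain ⟨i, hi, -⟩ := h.step k hk
  rw [hi]
  by_cases hj : j = i
  · subst hj
    simp
  · simp [hj]

theorem IsMonotoneLift.mono (h : IsMonotoneLift ε p Z) {a b : ℕ} (hab : a ≤ b)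
    (hb : b ≤ p.length) (j : Fin (n - 3)) : Z a j ≤ Z b j := by
  induction b, hab using Nat.le_induction with
  | base => exact le_rfl
  | succ b hab ih => exact (ih (by omega)).trans (h.le_succ (by omega) j)

theorem IsMonotoneLift.flipsAt_iff (hn : 4 < n) (h : IsMonotoneLift ε p Z) (k : ℕ)
    (d : Diagonal n) :
    FlipsAt p k d ↔ k < p.length ∧ Z k (d.label hn ε) = d.lo ε ∧
      Z (k + 1) (d.label hn ε) = d.lo ε + 1 := by
  have hd := d.hi_eq hn ε
  have hspec := d.spec hn ε
  constructor
  · rintro ⟨hk, i', hi', rfl⟩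
    obtain ⟨i, hi, hflip⟩ := h.step k hk
    obtain rfl := hflip.label_unique hi'
    have hch := (h.lifts k hk.le).chord_reindex i
    have h1 := h.mono (Nat.zero_le k) hk.le i
    have h2 := h.mono (a := k + 1) hk le_rfl i
    have e : Z (k + 1) i = Z k i + 1 := by rw [hi, Function.update_self]
    rw [h.last, e] at h2
    rw [h.zero, Pi.zero_apply] at h1
    -- Monotonicity between the known first and last sequences gives `0 ≤ Z k i` and `Z k i + i + 2
    -- < n`, so these integers really are the ranks of the ends, without wrap-around.
    obtain ⟨a, ha⟩ := Int.eq_ofNat_of_zero_le h1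
    rw [ha] at hch
    obtain ⟨e1, e2⟩ := Diagonal.lo_hi_eq (n := n) (a := a) (b := a + i.val + 2) (by omega) (by omega)
      (by rw [hch]; push_cast; rfl)
    have e3 : ((p.getVert k).1 (reindex ε i)).label hn ε = i := Fin.ext (by omega)
    rw [e3, e1]
    exact ⟨hk, ha, by rw [e, ha]⟩
  · rintro ⟨hk, h1, h2⟩
    obtain ⟨i, hi, hflip⟩ := h.step k hk
    have hid : d.label hn ε = i := by
      by_contra hne
      rw [hi, Function.update_of_ne hne] at h2
      omega
    refine ⟨hk, reindex ε i, hflip, Subtype.ext ?_⟩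
    rw [(h.lifts k hk.le).chord_reindex i, hspec.2.2.2, ← hid, h1, hd]
    push_cast
    rfl

/-- The flip time of `d` is the moment when the entry at its label passes the level `d.lo ε`. Each
entry is monotone and climbs past every level occurring for its label, so this happens exactly once.
-/
theorem IsMonotoneLift.exists_times (hn : 4 < n) (h : IsMonotoneLift ε p Z) :
    ∃ t : Diagonal n → ℕ, (∀ d k, FlipsAt p k d ↔ k = t d) ∧ Function.Injective t ∧
      ∀ d e, CoordLE (orientedRank ε) d e → t d ≤ t e := by
  have key : ∀ d : Diagonal n, ∃ t < p.length, ∀ k ≤ p.length,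
      (d.lo ε : ℤ) < Z k (d.label hn ε) ↔ t < k := by
    intro d
    have := d.hi_eq hn ε
    have := d.spec hn ε
    refine exists_crossing_time ?_ ?_ fun k hk => h.le_succ hk _
    · rw [h.zero]
      simp
    · rw [h.last]
      omega
  choose t ht htk using key
  have hflip : ∀ d, FlipsAt p (t d) d ∧
      Z (t d + 1) (d.label hn ε) = d.lo ε + 1 := by
    intro d
    have h1 := htk d (t d) (ht d).le
    have h2 := htk d (t d + 1) (ht d)
    obtain ⟨i, hi, -⟩ := h.step (t d) (ht d)
    have e : Z (t d + 1) (d.label hn ε) ≤ Z (t d) (d.label hn ε) + 1 := by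
      rw [hi]
      by_cases hj : d.label hn ε = i
      · rw [hj, Function.update_self]
      · rw [Function.update_of_ne hj]
        omega
    have : Z (t d + 1) (d.label hn ε) = d.lo ε + 1 := by omega
    exact ⟨(h.flipsAt_iff hn _ _).mpr ⟨ht d, by omega, this⟩, this⟩
  refine ⟨t, fun d k => ⟨fun hk => ?_, ?_⟩, fun d e hde => ?_, fun d e hde => ?_⟩
  · obtain ⟨hk, h1, h2⟩ := (h.flipsAt_iff hn _ _).mp hk
    have h3 := htk d k hk.le
    have h4 := htk d (k + 1) hk
    omega
  · rintro rfl
    exact (hflip d).1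
  · obtain ⟨-, i, hi, hd⟩ := (hflip d).1
    obtain ⟨-, j, hj, he⟩ := (hflip e).1
    rw [← hde] at hj he
    obtain rfl := hi.label_unique hj
    rw [← hd, ← he]
  · have hlo : d.lo ε ≤ e.lo ε := hde.1
    have hhi : d.hi ε ≤ e.hi ε := hde.2
    have hd := d.hi_eq hn ε
    have he := e.hi_eq hn ε
    -- Just after the flip of `e` its entry is `e.lo ε + 1`. Nesting then puts the entry of `d`
    -- above `d.lo ε`: left ends are compared if `d` has the smaller label, right ends otherwise.
    have h1 := (hflip e).2
    have h2 := htk d (t e + 1) (ht e)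
    have hs := (h.lifts (t e + 1) (ht e)).1.of_orient
    rcases le_total (d.label hn ε) (e.label hn ε) with hl | hl
    · have := hs.le hl
      omega
    · have := hs.le hl
      omega

end MonotoneLift

/-! ### Walks realizing linear extensions -/

theorem exists_rank_of_isLinearOrder {α : Type*} [Finite α] {r : α → α → Prop}
    (hr : IsLinearOrder α r) :
    ∃ (N : ℕ) (t : α → ℕ), (∀ x y, r x y ↔ t x ≤ t y) ∧ (∀ x, t x < N) ∧ ∀ k < N, ∃ x, t x = k := by
  classical
  have := Fintype.ofFinite α
  let _ : LinearOrder α :=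
    { le := r
      le_refl := hr.refl
      le_trans := fun _ _ _ => hr.trans _ _ _
      le_antisymm := fun _ _ => hr.antisymm _ _
      le_total := hr.total
      toDecidableLE := Classical.decRel _ }
  let f := (Fintype.orderIsoFinOfCardEq α rfl).symm
  refine ⟨Fintype.card α, fun x => f x, fun x y => ?_, fun x => (f x).isLt,
    fun k hk => ⟨f.symm ⟨k, hk⟩, by simp⟩⟩
  exact (f.le_iff_le (x := x) (y := y)).symm

theorem FlipsAt.concat {n : ℕ} {T T' T'' : CTFT n} {p : (Gamma n).Walk T T'} {k : ℕ}
    {d : Diagonal n} (h : FlipsAt p k d) (hadj : (Gamma n).Adj T' T'') :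
    FlipsAt (p.concat hadj) k d := by
  obtain ⟨hk, i, hi, hd⟩ := h
  have e : ∀ j ≤ p.length, (p.concat hadj).getVert j = p.getVert j := by
    intro j hj
    rw [SimpleGraph.Walk.concat_eq_append, SimpleGraph.Walk.getVert_append']
    simp [hj]
  refine ⟨by rw [SimpleGraph.Walk.length_concat]; omega, i, ?_, ?_⟩
  · rwa [e k hk.le, e (k + 1) hk]
  · rwa [e k hk.le]

theorem flipsAt_concat_length {n : ℕ} {T T' T'' : CTFT n} (p : (Gamma n).Walk T T')
    {i : Fin (n - 3)} (h : IsFlip i T' T'') :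
    FlipsAt (p.concat (show (Gamma n).Adj T' T'' from ⟨i, h⟩)) p.length (T'.1 i) := by
  have hadj : (Gamma n).Adj T' T'' := ⟨i, h⟩
  have e1 : (p.concat hadj).getVert p.length = T' := by
    rw [SimpleGraph.Walk.concat_eq_append, SimpleGraph.Walk.getVert_append']
    simp
  have e2 : (p.concat hadj).getVert (p.length + 1) = T'' := by
    rw [← SimpleGraph.Walk.length_concat p hadj, SimpleGraph.Walk.getVert_length]
  refine ⟨by rw [SimpleGraph.Walk.length_concat]; omega, i, ?_, ?_⟩
  · rwa [e1, e2]
  · rw [e1]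

/-- `Lifts.isFlip` lowers an entry; raising `Z i` is such a flip for `ε = false` and the inverse of
one for `ε = true`. -/
theorem isFlip_of_orient {n : ℕ} (hn : 4 < n) {ε : Bool} {Z : Fin (n - 3) → ℤ} {T T' : CTFT n}
    {i : Fin (n - 3)} (h : Lifts (orient ε Z) T.1)
    (h' : Lifts (orient ε (Function.update Z i (Z i + 1))) T'.1) :
    IsFlip (reindex ε i) T T' := by
  cases ε
  · refine h.isFlip hn ?_
    rw [orient_update] at h'
    convert h' using 2
    rw [orient_apply_reindex]
    simp only [sgn]
    simp
    ring
  · refine (h'.isFlip hn ?_).symm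
    convert h using 1
    rw [orient_update, Function.update_self, Function.update_idem]
    refine (Function.update_eq_self_iff).mpr ?_
    rw [orient_apply_reindex]
    simp [sgn]

theorem lifts_starReverse_orient {n : ℕ} (hn : 4 < n) (ε : Bool) :
    Lifts (orient ε fun i => (n : ℤ) - 2 - i.val) (starReverse n hn).1 := by
  cases ε
  · convert (lifts_starReverse hn).add_mul (-1) using 1
    funext i
    have := i.isLt
    simp only [orient, sgn, reindex, Bool.false_eq_true, if_false, Fin.val_rev]
    omega
  · convert lifts_starReverse hn using 1
    funext i
    simp [orient, sgn, reindex]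

/-- One step of the walk that realizes an order of the diagonals. -/
theorem exists_extension_step {n : ℕ} (hn : 4 < n) {ε : Bool} {t : Diagonal n → ℕ}
    (hinj : Function.Injective t) (ht : ∀ d e, CoordLE (orientedRank ε) d e → t d ≤ t e)
    {k : ℕ} {d : Diagonal n} (hd : t d = k) {Z : Fin (n - 3) → ℤ} (hZ : IsSlope Z)
    (hZ0 : ∀ i, 0 ≤ Z i)
    (hk : ∀ e : Diagonal n, (e.lo ε : ℤ) < Z (e.label hn ε) ↔ t e < k) :
    Z (d.label hn ε) = d.lo ε ∧
      IsSlope (Function.update Z (d.label hn ε) (Z (d.label hn ε) + 1)) := by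
  have hhi := d.hi_eq hn ε
  have hspec := d.spec hn ε
  have hnot := (hk d).not.mpr (by omega)
  -- Every diagonal strictly below `d` has already been flipped. It is applied to `[lo - 1, hi -
  -- 1]`, which has the label of `d`, and to `[lo - 1, hi]` and `[lo, hi - 1]`, which have the two
  -- neighbouring labels.
  have before : ∀ a b : ℕ, a + 2 ≤ b → b + 2 ≤ a + n → a ≤ d.lo ε → b ≤ d.hi ε →
      (a ≠ d.lo ε ∨ b ≠ d.hi ε) → ∀ l : Fin (n - 3), b = a + l.val + 2 → (a : ℤ) < Z l := by
    intro a b h1 h2 h3 h4 h5 l hl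
    obtain ⟨e, rfl, rfl⟩ := Diagonal.exists_lo_hi hn ε h1 (by omega) h2
    have hle := ht e d ⟨h3, h4⟩
    have hne : t e ≠ t d := by
      intro he
      obtain rfl := hinj he
      omega
    have hl' : l = e.label hn ε := by
      have := e.hi_eq hn ε
      exact Fin.ext (by omega)
    rw [hl', hk]
    omega
  have hZd : Z (d.label hn ε) = d.lo ε := by
    have h0 := hZ0 (d.label hn ε)
    by_contra hne
    have := before (d.lo ε - 1) (d.hi ε - 1) (by omega) (by omega) (by omega) (by omega)
      (by omega) (d.label hn ε) (by omega)
    omega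
  refine ⟨hZd, fun i j hij => ?_⟩
  have h1 := hZ i j hij
  by_cases hi : i = d.label hn ε
  · have hj : j ≠ d.label hn ε := by
      rintro rfl
      rw [hi] at hij
      omega
    rw [hi, Function.update_self, Function.update_of_ne hj]
    rw [hi] at h1 hij
    have h2 := hZ0 j
    have hjlt := j.isLt
    by_cases hlo : d.lo ε = 0
    · omega
    · have := before (d.lo ε - 1) (d.hi ε) (by omega) (by omega) (by omega) (by omega)
        (by omega) j (by omega)
      omega
  · rw [Function.update_of_ne hi]
    by_cases hj : j = d.label hn ε
    · rw [hj, Function.update_self]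
      rw [hj] at h1 hij
      have := before (d.lo ε) (d.hi ε - 1) (by omega) (by omega) (by omega) (by omega)
        (by omega) i (by omega)
      omega
    · rw [Function.update_of_ne hj]
      exact h1

/-- The invariant makes `Z` the boundary of the down-set of diagonals flipped so far: those with a
given label are exactly the ones with `lo` below that entry of `Z`. -/
theorem exists_walk_upto {n : ℕ} (hn : 4 < n) {ε : Bool} {t : Diagonal n → ℕ} {N : ℕ}
    (hinj : Function.Injective t) (hN : ∀ k < N, ∃ d, t d = k)
    (ht : ∀ d e, CoordLE (orientedRank ε) d e → t d ≤ t e) (k : ℕ) (hkN : k ≤ N) :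
    ∃ (T : CTFT n) (p : (Gamma n).Walk (star n hn) T) (Z : Fin (n - 3) → ℤ),
      p.length = k ∧ Lifts (orient ε Z) T.1 ∧ (∀ i, 0 ≤ Z i ∧ Z i ≤ (n : ℤ) - 2 - i.val) ∧
      ∑ i, Z i = k ∧ (∀ d : Diagonal n, (d.lo ε : ℤ) < Z (d.label hn ε) ↔ t d < k) ∧
      ∀ d, t d < k → FlipsAt p (t d) d := by
  induction k with
  | zero =>
    refine ⟨star n hn, .nil, 0, rfl, ?_, fun i => ⟨le_rfl, ?_⟩, by simp, by simp, by simp⟩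
    · convert lifts_star hn using 1
      funext i
      simp [orient]
    · have := i.isLt
      rw [Pi.zero_apply]
      omega
  | succ k ih =>
    obtain ⟨T, p, Z, hp, hl, hb, hsum, hk, hfl⟩ := ih (by omega)
    obtain ⟨d, hd⟩ := hN k (by omega)
    obtain ⟨hZd, hs⟩ := exists_extension_step hn hinj ht hd hl.1.of_orient (fun i => (hb i).1) hk
    obtain ⟨T', hl'⟩ := (hs.orient ε).exists_lifts hn
    have hflip := isFlip_of_orient hn hl hl'
    have hhi := d.hi_eq hn ε
    have hspec := d.spec hn ε
    have hTd : T.1 (reindex ε (d.label hn ε)) = d := by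
      refine Subtype.ext ?_
      rw [hl.chord_reindex, hspec.2.2.2, hZd, hhi]
      push_cast
      rfl
    have hadj : (Gamma n).Adj T T' := ⟨_, hflip⟩
    refine ⟨T', p.concat hadj, _, by rw [SimpleGraph.Walk.length_concat, hp], hl',
      fun i => ?_, ?_, fun e => ?_, fun e he => ?_⟩
    · by_cases hi : i = d.label hn ε
      · have := hb i
        rw [hi, Function.update_self]
        omega
      · rw [Function.update_of_ne hi]
        exact hb i
    · rw [sum_update_add, hsum]
      push_cast
      rfl
    · have hke := hk e
      by_cases hi : e.label hn ε = d.label hn ε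
      · rw [hi, Function.update_self]
        rw [hi] at hke
        constructor
        · intro h
          by_cases hlo : e.lo ε = d.lo ε
          · obtain rfl : e = d := Diagonal.eq_of_lo_hi hn hlo (by
              rw [e.hi_eq hn ε, hhi, hi, hlo])
            omega
          · omega
        · intro h
          by_cases he : t e = k
          · obtain rfl := hinj (he.trans hd.symm)
            omega
          · omega
      · rw [Function.update_of_ne hi, hke]
        have : t e ≠ k := by
          intro he
          obtain rfl := hinj (he.trans hd.symm)
          exact hi rfl
        omega
    · by_cases hek : t e = k
      · obtain rfl := hinj (hek.trans hd.symm)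
        have := flipsAt_concat_length p hflip
        rwa [hp, hTd, ← hek] at this
      · exact (hfl e (by omega)).concat _

theorem exists_walk_of_isLinearExtension {n : ℕ} (hn : 4 < n) {ε : Bool}
    {r : Diagonal n → Diagonal n → Prop} (hr : IsLinearExtension (CoordLE (orientedRank ε)) r) :
    ∃ p : (Gamma n).Walk (star n hn) (starReverse n hn), 2 * p.length = n * (n - 3) ∧
      ∃ t : Diagonal n → ℕ, (∀ d, FlipsAt p (t d) d) ∧ ∀ d e, r d e ↔ t d ≤ t e := by
  have : NeZero n := ⟨by omega⟩
  have : Finite (Diagonal n) := Subtype.finite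
  obtain ⟨N, t, hrt, htN, hN⟩ := exists_rank_of_isLinearOrder hr.1
  have hinj : Function.Injective t := fun x y hxy =>
    hr.1.antisymm _ _ ((hrt x y).mpr hxy.le) ((hrt y x).mpr hxy.ge)
  obtain ⟨T, p, Z, hp, hl, hb, hsum, hk, hfl⟩ := exists_walk_upto hn hinj hN
    (fun d e h => (hrt d e).mp (hr.2 d e h)) N le_rfl
  have hZ : Z = fun i => (n : ℤ) - 2 - i.val := by
    funext i
    have hi := i.isLt
    -- The highest diagonal with label `i`; once it is flipped, entry `i` has reached its upper
    -- bound.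
    obtain ⟨d, h1, h2⟩ := Diagonal.exists_lo_hi hn ε (a := n - 3 - i.val) (b := n - 1)
      (by omega) (by omega) (by omega)
    have h3 := d.hi_eq hn ε
    have h4 := (hk d).mpr (htN d)
    have h5 : d.label hn ε = i := Fin.ext (by omega)
    rw [h5] at h4
    have := hb i
    omega
  rw [hZ] at hl hsum
  obtain rfl := hl.eq (lifts_starReverse_orient hn ε)
  refine ⟨p, ?_, t, fun d => hfl d (htN d), hrt⟩
  -- The number of steps is read off from the final sum of entries, so the diagonals need not be
  -- counted.
  have h := two_mul_sum_sub hn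
  rw [hsum] at h
  zify [show 3 ≤ n by omega]
  rw [hp]
  exact h

/-- The lexicographic order, coded by `lo * n + hi` with `hi < n`. It supplies a walk attaining the
lower bound. -/
theorem exists_isLinearExtension {n : ℕ} (hn : 4 < n) (ε : Bool) :
    ∃ r : Diagonal n → Diagonal n → Prop, IsLinearExtension (CoordLE (orientedRank ε)) r := by
  have hinj : ∀ d e : Diagonal n, d.lo ε * n + d.hi ε = e.lo ε * n + e.hi ε → d = e := by
    intro d e h
    have h1 := (d.spec hn ε).2.1
    have h2 := (e.spec hn ε).2.1
    have h3 : d.lo ε = e.lo ε := by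
      rcases lt_trichotomy (d.lo ε) (e.lo ε) with hlt | heq | hlt
      · nlinarith
      · exact heq
      · nlinarith
    refine Diagonal.eq_of_lo_hi hn h3 ?_
    rw [h3] at h
    omega
  refine ⟨fun d e => d.lo ε * n + d.hi ε ≤ e.lo ε * n + e.hi ε,
    { refl := fun d => le_rfl
      trans := fun _ _ _ => le_trans
      antisymm := fun d e h1 h2 => hinj d e (le_antisymm h1 h2)
      total := fun _ _ => le_total _ _ }, fun d e h => ?_⟩
  have h1 : d.lo ε ≤ e.lo ε := h.1
  have h2 : d.hi ε ≤ e.hi ε := h.2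
  gcongr

/-! ### Geodesics and their flip orders -/

theorem isGeodesic_iff {n : ℕ} (hn : 4 < n)
    (p : (Gamma n).Walk (star n hn) (starReverse n hn)) :
    IsGeodesic p ↔ 2 * p.length = n * (n - 3) := by
  obtain ⟨r, hr⟩ := exists_isLinearExtension hn true
  obtain ⟨q, hq, -⟩ := exists_walk_of_isLinearExtension hn hr
  obtain ⟨w, hw⟩ := SimpleGraph.Reachable.exists_walk_length_eq_dist ⟨q⟩
  have h1 := (walk_length hn w).1
  have h2 := SimpleGraph.dist_le q
  rw [IsGeodesic]
  omega

theorem IsGeodesic.exists_times {n : ℕ} (hn : 4 < n)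
    {p : (Gamma n).Walk (star n hn) (starReverse n hn)} (hp : IsGeodesic p) :
    ∃ ε, ∃ t : Diagonal n → ℕ, (∀ d k, FlipsAt p k d ↔ k = t d) ∧ Function.Injective t ∧
      ∀ d e, CoordLE (orientedRank ε) d e → t d ≤ t e := by
  obtain ⟨ε, Z, hZ⟩ := (walk_length hn p).2 ((isGeodesic_iff hn p).mp hp).le
  exact ⟨ε, hZ.exists_times hn⟩

theorem isLinearOrder_of_injective {α : Type*} {t : α → ℕ} (ht : Function.Injective t)
    {r : α → α → Prop} (hr : ∀ x y, r x y ↔ t x ≤ t y) : IsLinearOrder α r where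
  refl x := (hr x x).mpr le_rfl
  trans x y z h1 h2 := (hr x z).mpr (((hr x y).mp h1).trans ((hr y z).mp h2))
  antisymm x y h1 h2 := ht (le_antisymm ((hr x y).mp h1) ((hr y x).mp h2))
  total x y := by
    rw [hr, hr]
    exact le_total _ _

theorem exists_geodesic_iff {n : ℕ} (hn : 4 < n) (r : Diagonal n → Diagonal n → Prop) :
    (∃ p : (Gamma n).Walk (star n hn) (starReverse n hn), IsGeodesic p ∧ IsFlipOrder p r) ↔
      ∃ ε, IsLinearExtension (CoordLE (orientedRank ε)) r := by
  constructor
  · rintro ⟨p, hp, t, ht, hr⟩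
    obtain ⟨ε, t', ht', hinj, hle⟩ := hp.exists_times hn
    obtain rfl : t = t' := funext fun d => (ht' d _).mp ((ht d _).mpr rfl)
    exact ⟨ε, isLinearOrder_of_injective hinj hr, fun d e h => (hr d e).mpr (hle d e h)⟩
  · rintro ⟨ε, hr⟩
    obtain ⟨p, hp, t, ht, hrt⟩ := exists_walk_of_isLinearExtension hn hr
    have hgeo := (isGeodesic_iff hn p).mpr hp
    obtain ⟨_, t', ht', -, -⟩ := hgeo.exists_times hn
    -- The constructed walk is only known to flip `d` at time `t d`; that it does so at no other
    -- time follows from its being a geodesic.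
    obtain rfl : t = t' := funext fun d => (ht' d _).mp (ht d)
    exact ⟨p, hgeo, t, ht', hrt⟩

end FlipGraph

theorem mainTheorem2 (n : ℕ) (hn : 4 < n) :
    (∀ p : (FlipGraph.Gamma n).Walk (FlipGraph.star n hn) (FlipGraph.starReverse n hn),
      FlipGraph.IsGeodesic p →
        ∃ r, IsLinearOrder (FlipGraph.Diagonal n) r ∧ FlipGraph.IsFlipOrder p r) ∧
    ∀ r : FlipGraph.Diagonal n → FlipGraph.Diagonal n → Prop,
      (∃ p : (FlipGraph.Gamma n).Walk (FlipGraph.star n hn) (FlipGraph.starReverse n hn),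
        FlipGraph.IsGeodesic p ∧ FlipGraph.IsFlipOrder p r) ↔
      (FlipGraph.IsLinearExtension (FlipGraph.CoordLE FlipGraph.naturalRank) r ∨
        FlipGraph.IsLinearExtension (FlipGraph.CoordLE FlipGraph.reversedRank) r) := by
  refine ⟨fun p hp => ?_, fun r => ?_⟩
  · obtain ⟨ε, t, ht, hinj, -⟩ := hp.exists_times hn
    exact ⟨fun d e => t d ≤ t e,
      FlipGraph.isLinearOrder_of_injective hinj fun _ _ => Iff.rfl, t, ht, fun _ _ => Iff.rfl⟩
  · rw [FlipGraph.exists_geodesic_iff hn, Bool.exists_bool, FlipGraph.orientedRank_true,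
      FlipGraph.orientedRank_false, or_comm]
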